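/- **Lemma (Termination).** *Setting.* Let $\mathbf Q_0\subseteq\mathbb Q\cap(0,1)$. Roles are role names $R$ and their inverses $R^-$ ($\mathsf{Inv}(R)=R^-$, $\mathsf{Inv}(R^-)=R$); some role names are transitive, and a role is transitive if it is a transitive role name or the inverse of one. A role hierarchy $\mathcal R^+$ is given by a finite set $\mathcal R$ of inclusions $R\sqsubseteq S$ between roles; $\sqsubseteq^+$ is the reflexive transitive closure of $\sqsubseteq$ over $\mathcal R\cup\{\mathsf{Inv}(R)\sqsubseteq\mathsf{Inv}(S)\mid R\sqsubseteq S\in\mathcal R\}$, and it is acyclic (antisymmetric). A role is simple if no $S\sqsubseteq^+R$ is transitive. $\mathcal{ALCQPIH}_{R^+}$-concepts are built from concept names by $\neg,\sqcap,\sqcup$, by $\forall R.C,\exists R.C$, and, for simple $R$, $n\ge 0$, $r\in\mathbf Q_0$, by $\geqslant nR.C$, $\leqslant nR.C$, $MrR.C$ (more than the part $r$ of the $R$-neighbours is in $C$) and $WrR.C$ (at most the part $r$ of the $R$-neighbours is not in $C$). ${\sim}C$ is the negation normal form (NNF) of $\neg C$. $\boxtimes$ stands for any of $\exists,\geqslant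 n,\leqslant n,Mr,Wr$. *Completion trees.* A completion tree $\mathbf T$ is a finite tree whose nodes carry sets $\mathcal L(x)$ of concepts and whose edges carry sets $\mathcal L(\langle x,y\rangle)$ of roles; if $z$ is the predecessor of $x$, then $\mathcal L(\langle x,z\rangle)$ means $\{\mathsf{Inv}(S)\mid S\in\mathcal L(\langle z,x\rangle)\}$. A successor $y$ of $x$ is an $R$-successor if some $S\in\mathcal L(\langle x,y\rangle)$ has $S\sqsubseteq^+R$; $y$ is an $R$-neighbour of $x$ if $y$ is an $R$-successor of $x$ or $x$ is an $\mathsf{Inv}(R)$-successor of $y$. $R^{\mathbf T}(x)$ is the set of $R$-neighbours of $x$, and $R^{\mathbf T}(x,C)$ the set of those labelled with $C$. A node $x$ with predecessor $x'$ is directly blocked if none of its ancestors is blocked and it has a proper ancestor $y$ with predecessor $y'$ such that $\mathcal L(x)=\mathcal L(y)$, $\mathcal L(x')=\mathcal L(y')$, $\mathcal L(\langle x',x\rangle)=\mathcal L(\langle y',y\rangle)$; it is indirectly blocked if its predecessor is blocked or $\mathcal L(\langle x',x\rangle)=\emptyset$; blocked means directly or indirectly blocked. *The algorithm* starts, for a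 concept $D$ in NNF, with a single node labelled $\{D\}$ and applies the following rules. Non-generating rules, for $x$ not indirectly blocked: ($\sqcap$) if $C_1\sqcap C_2\in\mathcal L(x)$ and $\{C_1,C_2\}\not\subseteq\mathcal L(x)$, add $C_1,C_2$ to $\mathcal L(x)$; ($\sqcup$) if $C_1\sqcup C_2\in\mathcal L(x)$ and $\{C_1,C_2\}\cap\mathcal L(x)=\emptyset$, add $C_1$ or $C_2$; ($\forall$) if $\forall R.C\in\mathcal L(x)$ and an $R$-neighbour $y$ has $C\notin\mathcal L(y)$, add $C$ to $\mathcal L(y)$; ($\forall_+$) if $\forall S.C\in\mathcal L(x)$, $R\sqsubseteq^+S$ is transitive and an $R$-neighbour $y$ has $\forall R.C\notin\mathcal L(y)$, add $\forall R.C$ to $\mathcal L(y)$; (choose) if $\boxtimes R.C\in\mathcal L(x)$ and an $R$-neighbour $y$ has $\{C,{\sim}C\}\cap\mathcal L(y)=\emptyset$, add $C$ or ${\sim}C$ to $\mathcal L(y)$; ($\leqslant$) if $\leqslant nR.C\in\mathcal L(x)$, $\sharp R^{\mathbf T}(x,C)>n$ and $y\neq z$ in $R^{\mathbf T}(x,C)$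 satisfy $\mathcal L(\langle x,y\rangle)\cap\mathcal L(\langle x,z\rangle)=\emptyset$, $y$ not the predecessor of $x$, then add $\mathcal L(y)$ to $\mathcal L(z)$, add $\mathcal L(\langle x,y\rangle)$ to $\mathcal L(\langle x,z\rangle)$ (if $z$ is the predecessor of $x$: add the inverses of its roles to $\mathcal L(\langle z,x\rangle)$), and set $\mathcal L(\langle x,y\rangle)=\emptyset$. Generating rules, for $x$ not blocked, each creating a new successor $y$ of $x$ with $\mathcal L(\langle x,y\rangle)=\{R\}$, $\mathcal L(y)=\{C\}$: ($\exists$) if $\exists R.C\in\mathcal L(x)$ and $R^{\mathbf T}(x,C)=\emptyset$; ($\geqslant$) if $\geqslant nR.C\in\mathcal L(x)$ and $\sharp R^{\mathbf T}(x,C)<n$; ($M$) if $MrR.C\in\mathcal L(x)$, $\sharp R^{\mathbf T}(x,C)\le r\,\sharp R^{\mathbf T}(x)$ and $\sharp R^{\mathbf T}(x)<BAN_x$; ($W$) if $WrR.C\in\mathcal L(x)$, $\sharp R^{\mathbf T}(x,{\sim}C)>r\,\sharp R^{\mathbf T}(x)$ and $\sharp R^{\mathbf T}(x)<BAN_x$.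 A generating rule is applied only if no non-generating rule is applicable anywhere in the tree; otherwise all choices are free. *The number $BAN_x$.* Let $\bar n$ be the sum of the numbers $n$ over all restrictions $\geqslant nS.E$ in the set obtained from $\mathcal L(x)$ by replacing each $\exists S.E$ with $\geqslant 1S.E$ and adding $\geqslant 1S.E$ whenever $x$ is an $\mathsf{Inv}(S)$-successor of its predecessor $u$ and $E\in\mathcal L(u)$. Put $\bar r=r$ for $MrR.C$ and $\bar r=1-r$ for $WrR.C$. Let $\mathbf R^P_x$ be the set of outermost roles of the part restrictions ($M$- and $W$-concepts) in $\mathcal L(x)$. For $R\in\mathbf R^P_x$ let $B_R=\bar n$ if $R$ has no proper sub-role in $\mathbf R^P_x$, and otherwise let $B_R$ be the sum of $N_S$ over the direct (i.e. maximal proper) sub-roles $S$ of $R$ in $\mathbf R^P_x$; let $N_R$ be the maximum of $\lfloor B_R/(1-\sum_{K}\bar r)\rfloor+|K|$ over the nonempty sets $K$ of part restrictions in $\mathcal L(x)$ with role $R$ and $\sum_K\bar r<1$, and $N_R=1$ if there is no such $K$. Then $BAN_x$ is the maximum of $N_R$ over the roles $R$ maximal in $\mathbf R^P_x$, times the least common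 multiple of the (reduced) denominators of the indices $r'$ of those $Wr'R.C\in\mathcal L(x)$ for which the indices of some $k\ge 1$ other $W$-concepts in $\mathcal L(x)$ sum up to $1-r'$ (the factor is $1$ if there are none). *Claim.* For every $\mathcal{ALCQPIH}_{R^+}$-concept $D$ in NNF and every role hierarchy $\mathcal R^+$ the algorithm terminates: there is a number $N$, depending on $D$ and $\mathcal R^+$, such that every sequence of rule applications starting from the initial tree has length at most $N$. Moreover, let $n_0=|D|$ be the number of symbols of $D$ (numbers in binary), and let $k$ be the number of the roles which occur in $D$ or in $\mathcal R$, together with their inverses. Then in every tree generated by the algorithm 1. all paths from the root have length at most $2^{4n_0k}$; 2. every node has at most $c\cdot 2^{m^2}$ successors, where $m=\max(n_0,k/2)$ and $c$ is an absolute constant. In particular, the out-degree is bounded by $O(2^{n_0^2})$ if $k\le 2n_0$, which is the case whenever all roles of $\mathcal R$ occur, up to inverses, in $D$. -/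

import Mathlib

open scoped Classical

universe u v

namespace ALCQPIH

/-! ### Roles and role hierarchies -/

/-- A role is a role name or the inverse of a role name. -/
inductive Role (NR : Type v) : Type v
  | name : NR → Role NR
  | inv : NR → Role NR

/-- The function `Inv`. -/
def Role.Inv {NR : Type v} : Role NR → Role NR
  | .name a => .inv a
  | .inv a => .name a

/-- `R ⊑ S` is an axiom of `ax`, or `Inv R ⊑ Inv S` is one. -/
def BaseSub {NR : Type v} (ax : Finset (Role NR × Role NR)) (R S : Role NR) : Prop :=
  (R, S) ∈ ax ∨ (R.Inv, S.Inv) ∈ ax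

/-- A finite set of role inclusion axioms without cycles, together with the set of
the transitive role names. -/
structure Hierarchy (NR : Type v) where
  transNames : Set NR
  ax : Finset (Role NR × Role NR)
  acyclic : ∀ R S : Role NR, Relation.ReflTransGen (BaseSub ax) R S →
    Relation.ReflTransGen (BaseSub ax) S R → R = S

namespace Hierarchy

variable {NR : Type v} (H : Hierarchy NR)

/-- `R ⊑⁺ S`: the reflexive and transitive closure of `⊑`. -/
def Sub (R S : Role NR) : Prop := Relation.ReflTransGen (BaseSub H.ax) R S

/-- `R` is a proper sub-role of `S`. -/
def SSub (R S : Role NR) : Prop := H.Sub R S ∧ R ≠ S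

theorem SSub.trans {H : Hierarchy NR} {R S P : Role NR} (h : H.SSub R S) (h' : H.SSub S P) :
    H.SSub R P := by
  refine ⟨Relation.ReflTransGen.trans h.1 h'.1, ?_⟩
  rintro rfl
  exact h.2 (H.acyclic _ _ h.1 h'.1)

/-- A role is transitive if it is a transitive role name or the inverse of one. -/
def Trans : Role NR → Prop
  | .name a => a ∈ H.transNames
  | .inv a => a ∈ H.transNames

/-- A role is simple if neither it nor any of its sub-roles is transitive. -/
def Simple (R : Role NR) : Prop := ∀ S, H.Sub S R → ¬ H.Trans S

/-- The roles that occur in the axioms, and their inverses. -/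
noncomputable def roles : Finset (Role NR) :=
  let A := H.ax.image Prod.fst ∪ H.ax.image Prod.snd
  A ∪ A.image Role.Inv

/-- The finite set of all `S` with `R ⊑⁺ S`. -/
noncomputable def supers (R : Role NR) : Finset (Role NR) :=
  insert R (H.roles.filter fun S => H.Sub R S)

end Hierarchy

/-! ### Concepts -/

inductive Concept (NC : Type u) (NR : Type v) : Type (max u v)
  | atom : NC → Concept NC NR
  | neg : Concept NC NR → Concept NC NR
  | and : Concept NC NR → Concept NC NR → Concept NC NR
  | or : Concept NC NR → Concept NC NR → Concept NC NR
  | all : Role NR → Concept NC NR → Concept NC NR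
  | ex : Role NR → Concept NC NR → Concept NC NR
  | atLeast : ℕ → Role NR → Concept NC NR → Concept NC NR
  | atMost : ℕ → Role NR → Concept NC NR → Concept NC NR
  /-- `M r R.C`: more than the part `r` of the `R`-neighbours is in `C`. -/
  | M : ℚ → Role NR → Concept NC NR → Concept NC NR
  /-- `W r R.C`: at most the part `r` of the `R`-neighbours is not in `C`. -/
  | W : ℚ → Role NR → Concept NC NR → Concept NC NR

namespace Concept

variable {NC : Type u} {NR : Type v}

/-- The formation rules: number restrictions and part restrictions carry simple roles only,
and the indices of the part restrictions come from `Q₀`. -/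
def IsConcept (Q₀ : Set ℚ) (H : Hierarchy NR) : Concept NC NR → Prop
  | atom _ => True
  | neg C => C.IsConcept Q₀ H
  | and C D => C.IsConcept Q₀ H ∧ D.IsConcept Q₀ H
  | or C D => C.IsConcept Q₀ H ∧ D.IsConcept Q₀ H
  | all _ C => C.IsConcept Q₀ H
  | ex _ C => C.IsConcept Q₀ H
  | atLeast _ R C => H.Simple R ∧ C.IsConcept Q₀ H
  | atMost _ R C => H.Simple R ∧ C.IsConcept Q₀ H
  | M r R C => r ∈ Q₀ ∧ H.Simple R ∧ C.IsConcept Q₀ H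
  | W r R C => r ∈ Q₀ ∧ H.Simple R ∧ C.IsConcept Q₀ H

/-- The first concept name that occurs in a concept. -/
def firstName : Concept NC NR → NC
  | atom A => A
  | neg C => C.firstName
  | and C _ => C.firstName
  | or C _ => C.firstName
  | all _ C => C.firstName
  | ex _ C => C.firstName
  | atLeast _ _ C => C.firstName
  | atMost _ _ C => C.firstName
  | M _ _ C => C.firstName
  | W _ _ C => C.firstName

/-- `nnfAux true C` is the negation normal form of `C`, and `nnfAux false C` that of `¬ C`.
The negation of the tautology `≥ 0 R.C` is the contradiction `A ⊓ ¬A`, for a concept name `A`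
that occurs in `C`. -/
def nnfAux : Bool → Concept NC NR → Concept NC NR
  | true, atom A => atom A
  | false, atom A => neg (atom A)
  | b, neg C => nnfAux (!b) C
  | true, and C D => and (nnfAux true C) (nnfAux true D)
  | false, and C D => or (nnfAux false C) (nnfAux false D)
  | true, or C D => or (nnfAux true C) (nnfAux true D)
  | false, or C D => and (nnfAux false C) (nnfAux false D)
  | true, all R C => all R (nnfAux true C)
  | false, all R C => ex R (nnfAux false C)
  | true, ex R C => ex R (nnfAux true C)
  | false, ex R C => all R (nnfAux false C)
  | true, atLeast n R C => atLeast n R (nnfAux true C)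
  | false, atLeast 0 _ C => and (atom C.firstName) (neg (atom C.firstName))
  | false, atLeast (n + 1) R C => atMost n R (nnfAux true C)
  | true, atMost n R C => atMost n R (nnfAux true C)
  | false, atMost n R C => atLeast (n + 1) R (nnfAux true C)
  | true, M r R C => M r R (nnfAux true C)
  | false, M r R C => W r R (nnfAux false C)
  | true, W r R C => W r R (nnfAux true C)
  | false, W r R C => M r R (nnfAux false C)

/-- Negation normal form. -/
def nnf (C : Concept NC NR) : Concept NC NR := nnfAux true C

/-- `∼C`, the negation normal form of `¬ C`. -/
def compl (C : Concept NC NR) : Concept NC NR := nnfAux false C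

/-- The number of binary digits of `n`. -/
def numLength (n : ℕ) : ℕ := max 1 n.size

/-- The length of a concept: the number of its symbols, with numbers in binary. -/
def length : Concept NC NR → ℕ
  | atom _ => 1
  | neg C => 1 + C.length
  | and C D => 1 + C.length + D.length
  | or C D => 1 + C.length + D.length
  | all _ C => 2 + C.length
  | ex _ C => 2 + C.length
  | atLeast n _ C => 2 + numLength n + C.length
  | atMost n _ C => 2 + numLength n + C.length
  | M r _ C => 2 + numLength r.num.natAbs + numLength r.den + C.length
  | W r _ C => 2 + numLength r.num.natAbs + numLength r.den + C.length

/-- The roles that occur in a concept. -/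
noncomputable def occRoles : Concept NC NR → Finset (Role NR)
  | atom _ => ∅
  | neg C => C.occRoles
  | and C D => C.occRoles ∪ D.occRoles
  | or C D => C.occRoles ∪ D.occRoles
  | all R C => insert R C.occRoles
  | ex R C => insert R C.occRoles
  | atLeast _ R C => insert R C.occRoles
  | atMost _ R C => insert R C.occRoles
  | M _ R C => insert R C.occRoles
  | W _ R C => insert R C.occRoles

/-- The roles that occur in `D` or in the role hierarchy, and their inverses. -/
noncomputable def rolesWith (D : Concept NC NR) (H : Hierarchy NR) : Finset (Role NR) :=
  D.occRoles ∪ D.occRoles.image Role.Inv ∪ H.roles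

/-- The pair `(R, C)` of a concept `⊠ R.C`, where `⊠` is one of `∃`, `≥ n`, `≤ n`, `M r`, `W r`. -/
def box : Concept NC NR → Option (Role NR × Concept NC NR)
  | ex R C => some (R, C)
  | atLeast _ R C => some (R, C)
  | atMost _ R C => some (R, C)
  | M _ R C => some (R, C)
  | W _ R C => some (R, C)
  | _ => none

/-- The uppermost role of a part restriction. -/
def partRole : Concept NC NR → Option (Role NR)
  | M _ R _ => some R
  | W _ R _ => some R
  | _ => none

/-- The index `r̄` of a part restriction: `r` for `M r R.C`, and `1 - r` for `W r R.C`. -/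
def rbar : Concept NC NR → ℚ
  | M r _ _ => r
  | W r _ _ => 1 - r
  | _ => 0

/-- The index `r` of a `W` part restriction. -/
def wIndex : Concept NC NR → Option ℚ
  | W r _ _ => some r
  | _ => none

/-- `∃ R.C` is replaced with `≥ 1 R.C`. -/
def exToAtLeast : Concept NC NR → Concept NC NR
  | ex R C => atLeast 1 R C
  | C => C

/-- The number `n` of an "at least" restriction `≥ n R.C`, and `0` for other concepts. -/
def atLeastNum : Concept NC NR → ℕ
  | atLeast n _ _ => n
  | _ => 0

end Concept

/-! ### The border amount of neighbours -/

section BAN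

variable {NC : Type u} {NR : Type v}

/-- The roles at the uppermost level in the part restrictions of a label. -/
noncomputable def partRoles (L : Finset (Concept NC NR)) : Finset (Role NR) :=
  L.biUnion fun C => C.partRole.toFinset

/-- The part restrictions of a label with uppermost role `R`. -/
noncomputable def cluster (L : Finset (Concept NC NR)) (R : Role NR) : Finset (Concept NC NR) :=
  L.filter fun C => C.partRole = some R

/-- The direct sub-roles of `R` among the part roles of a label. -/
noncomputable def directSubs (H : Hierarchy NR) (L : Finset (Concept NC NR)) (R : Role NR) :
    Finset (Role NR) :=
  (partRoles L).filter fun S => H.SSub S R ∧ ¬ ∃ P ∈ partRoles L, H.SSub S P ∧ H.SSub P R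

/-- The combinations of part restrictions of a cluster whose indices sum up to less than `1`. -/
noncomputable def combinations (Cl : Finset (Concept NC NR)) : Finset (Finset (Concept NC NR)) :=
  Cl.powerset.filter fun K => K.Nonempty ∧ ∑ C ∈ K, C.rbar < 1

/-- The satisfaction number of a cluster over the base number `B`. -/
noncomputable def clusterNum (Cl : Finset (Concept NC NR)) (B : ℕ) : ℕ :=
  if (combinations Cl).Nonempty then
    (combinations Cl).sup fun K => ⌊(B : ℚ) / (1 - ∑ C ∈ K, C.rbar)⌋₊ + K.card
  else 1

theorem card_lt_of_mem_directSubs {H : Hierarchy NR} {L : Finset (Concept NC NR)}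
    {R S : Role NR} (hS : S ∈ directSubs H L R) :
    ((partRoles L).filter fun P => H.SSub P S).card <
      ((partRoles L).filter fun P => H.SSub P R).card := by
  obtain ⟨hSL, hSR, -⟩ := Finset.mem_filter.1 hS
  refine Finset.card_lt_card ⟨fun P hP => ?_, fun h => ?_⟩
  · obtain ⟨h1, h2⟩ := Finset.mem_filter.1 hP
    exact Finset.mem_filter.2 ⟨h1, h2.trans hSR⟩
  · exact (Finset.mem_filter.1 (h (Finset.mem_filter.2 ⟨hSL, hSR⟩))).2.2 rfl

/-- The satisfaction number of the role `R`. The base number is `nbar` for an initial role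
(one without proper sub-roles among the part roles), and the sum of the satisfaction numbers of
the direct sub-roles for any other role. -/
noncomputable def satNum (H : Hierarchy NR) (L : Finset (Concept NC NR)) (nbar : ℕ)
    (R : Role NR) : ℕ :=
  clusterNum (cluster L R)
    (if ∀ S ∈ partRoles L, ¬ H.SSub S R then nbar
     else ∑ S ∈ (directSubs H L R).attach, satNum H L nbar S.1)
termination_by ((partRoles L).filter fun P => H.SSub P R).card
decreasing_by exact card_lt_of_mem_directSubs S.2

/-- The maximum of the satisfaction numbers of the final roles. -/
noncomputable def banClusters (H : Hierarchy NR) (L : Finset (Concept NC NR)) (nbar : ℕ) : ℕ :=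
  ((partRoles L).filter fun R => ∀ S ∈ partRoles L, ¬ H.SSub R S).sup (satNum H L nbar)

/-- The `W` part restrictions of `L` whose index, together with the indices of one or more other
`W` part restrictions of `L`, sums up to `1`. -/
noncomputable def wOne (L : Finset (Concept NC NR)) : Finset (Concept NC NR) :=
  L.filter fun C => ∃ r, C.wIndex = some r ∧
    ∃ K ⊆ (L.erase C).filter (fun E => E.wIndex.isSome),
      K.Nonempty ∧ ∑ E ∈ K, E.wIndex.getD 0 + r = 1

/-- The least common multiple of the denominators of the indices in `wOne L` (`1` if there is none). -/
noncomputable def lcmOne (L : Finset (Concept NC NR)) : ℕ :=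
  (wOne L).lcm fun C => (C.wIndex.getD 0).den

end BAN

/-! ### Completion trees -/

/-- The nodes are addresses: `[]` is the root, and the successors of `x` are of the form `i :: x`.
`edge (i :: x)` is the label of the edge from `x` to `i :: x`. -/
structure CTree (NC : Type u) (NR : Type v) where
  nodes : Finset (List ℕ)
  label : List ℕ → Finset (Concept NC NR)
  edge : List ℕ → Finset (Role NR)

/-- The address `y` is a successor of the address `x`. -/
def IsSucc (y x : List ℕ) : Prop := ∃ i : ℕ, y = i :: x

namespace CTree

variable {NC : Type u} {NR : Type v}

/-- The initial tree: a single node labelled with `{D}`. -/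
noncomputable def init (D : Concept NC NR) : CTree NC NR where
  nodes := {[]}
  label := fun x => if x = [] then {D} else ∅
  edge := fun _ => ∅

variable (T : CTree NC NR)

/-- The number of successors of `x`. -/
noncomputable def outDegree (x : List ℕ) : ℕ := (T.nodes.filter fun y => IsSucc y x).card

/-- `y` is an `R`-successor of `x`. -/
def RSucc (H : Hierarchy NR) (R : Role NR) (x y : List ℕ) : Prop :=
  IsSucc y x ∧ ∃ S ∈ T.edge y, H.Sub S R

/-- `y` is an `R`-neighbour of `x`. -/
def RNbr (H : Hierarchy NR) (R : Role NR) (x y : List ℕ) : Prop :=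
  T.RSucc H R x y ∨ T.RSucc H R.Inv y x

/-- The set of the `R`-neighbours of `x`. -/
noncomputable def nbrs (H : Hierarchy NR) (R : Role NR) (x : List ℕ) : Finset (List ℕ) :=
  T.nodes.filter fun y => T.RNbr H R x y

/-- The set of the `R`-neighbours of `x` labelled with `C`. -/
noncomputable def nbrsWith (H : Hierarchy NR) (R : Role NR) (x : List ℕ) (C : Concept NC NR) :
    Finset (List ℕ) :=
  (T.nbrs H R x).filter fun y => C ∈ T.label y

/-- The label of the edge between `x` and its neighbour `z`, read from `x` to `z`: if `z` is the
predecessor of `x`, it consists of the inverses of the roles on the edge from `z` to `x`. -/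
noncomputable def edgeBetween (x z : List ℕ) : Finset (Role NR) :=
  if IsSucc z x then T.edge z
  else if IsSucc x z then (T.edge x).image Role.Inv
  else ∅

/-- Some proper ancestor `y` of `x`, with predecessor `y'`, has the same label as `x`, and the
labels of the predecessors and those of the edges leading to `x` and `y` also coincide. -/
def PairMatch : List ℕ → Prop
  | [] => False
  | i :: x' => ∃ (j : ℕ) (y' : List ℕ), (j :: y') <:+ x' ∧
      T.label (i :: x') = T.label (j :: y') ∧ T.label x' = T.label y' ∧
      T.edge (i :: x') = T.edge (j :: y')

/-- `x` is blocked, directly or indirectly; `blocked_iff` below is the definition in words. -/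
def Blocked : List ℕ → Prop
  | [] => False
  | i :: x' => Blocked x' ∨ T.edge (i :: x') = ∅ ∨ T.PairMatch (i :: x')

/-- The predecessor of `x` is blocked, or `x` has been merged into another node, so that the edge
leading to `x` has the empty label. -/
def IndirectlyBlocked : List ℕ → Prop
  | [] => False
  | i :: x' => T.Blocked x' ∨ T.edge (i :: x') = ∅

/-- No proper ancestor of `x` is blocked, and `x` matches a proper ancestor. -/
def DirectlyBlocked (x : List ℕ) : Prop :=
  (∀ a, a <:+ x → a ≠ x → ¬ T.Blocked a) ∧ T.PairMatch x

theorem blocked_of_suffix {a : List ℕ} : ∀ {x : List ℕ}, a <:+ x → T.Blocked a → T.Blocked x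
  | [], h, ha => by rwa [List.suffix_nil.1 h] at ha
  | _ :: _, h, ha => by
    rcases List.suffix_cons_iff.1 h with rfl | h
    · exact ha
    · exact Or.inl (blocked_of_suffix h ha)

theorem blocked_iff (x : List ℕ) :
    T.Blocked x ↔ T.DirectlyBlocked x ∨ T.IndirectlyBlocked x := by
  cases x with
  | nil => simp [Blocked, DirectlyBlocked, IndirectlyBlocked, PairMatch]
  | cons i x' =>
    constructor
    · intro h
      by_cases hb : T.Blocked x'
      · exact Or.inr (Or.inl hb)
      · rcases h with h | h | h
        · exact absurd h hb
        · exact Or.inr (Or.inr h)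
        · refine Or.inl ⟨fun a ha hne hab => hb ?_, h⟩
          rcases List.suffix_cons_iff.1 ha with rfl | ha
          · exact absurd rfl hne
          · exact T.blocked_of_suffix ha hab
    · rintro (⟨-, h⟩ | h | h)
      · exact Or.inr (Or.inr h)
      · exact Or.inl h
      · exact Or.inr (Or.inl h)

/-- The restrictions `≥ 1 S.E` assumed in the label of a node `x` on account of its predecessor
`u`: `x` is an `Inv S`-successor of `u`, and `E` is in the label of `u`. -/
noncomputable def inherited (H : Hierarchy NR) : List ℕ → Finset (Concept NC NR)
  | [] => ∅
  | i :: u =>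
    ((((T.edge (i :: u)).biUnion H.supers).image Role.Inv) ×ˢ T.label u).image
      fun p => Concept.atLeast 1 p.1 p.2

/-- The sum of the numbers in all "at least" restrictions at `x`, where `∃ R.C` is read as
`≥ 1 R.C`, and where the restrictions inherited from the predecessor are included. -/
noncomputable def nbar (H : Hierarchy NR) (x : List ℕ) : ℕ :=
  ∑ C ∈ (T.label x).image Concept.exToAtLeast ∪ T.inherited H x, C.atLeastNum

/-- The border amount of neighbours of `x`. -/
noncomputable def BAN (H : Hierarchy NR) (x : List ℕ) : ℕ :=
  banClusters H (T.label x) (T.nbar H x) * lcmOne (T.label x)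

/-! ### The completion rules -/

/-- Add the concepts in `A` to the label of `y`. -/
noncomputable def addConcepts (y : List ℕ) (A : Finset (Concept NC NR)) : CTree NC NR where
  nodes := T.nodes
  label := Function.update T.label y (T.label y ∪ A)
  edge := T.edge

/-- Create the node `y`, with edge label `{R}` and node label `{C}`. -/
noncomputable def addNode (y : List ℕ) (R : Role NR) (C : Concept NC NR) : CTree NC NR where
  nodes := insert y T.nodes
  label := Function.update T.label y {C}
  edge := Function.update T.edge y {R}

/-- Merge the successor `y` of `x` into the neighbour `z` of `x`. -/
noncomputable def merge (x y z : List ℕ) : CTree NC NR where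
  nodes := T.nodes
  label := Function.update T.label z (T.label z ∪ T.label y)
  edge := Function.update
    (if IsSucc x z then Function.update T.edge x (T.edge x ∪ (T.edge y).image Role.Inv)
     else Function.update T.edge z (T.edge z ∪ T.edge y))
    y ∅

/-- The applications of the non-generating rules. -/
inductive NonGen (H : Hierarchy NR) (T : CTree NC NR) : CTree NC NR → Prop
  | and_rule (x : List ℕ) (C₁ C₂ : Concept NC NR) :
      x ∈ T.nodes → Concept.and C₁ C₂ ∈ T.label x → ¬ T.IndirectlyBlocked x →
      ¬ (C₁ ∈ T.label x ∧ C₂ ∈ T.label x) →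
      NonGen H T (T.addConcepts x {C₁, C₂})
  | or_rule (x : List ℕ) (C₁ C₂ E : Concept NC NR) :
      x ∈ T.nodes → Concept.or C₁ C₂ ∈ T.label x → ¬ T.IndirectlyBlocked x →
      C₁ ∉ T.label x → C₂ ∉ T.label x → (E = C₁ ∨ E = C₂) →
      NonGen H T (T.addConcepts x {E})
  | all_rule (x y : List ℕ) (R : Role NR) (C : Concept NC NR) :
      x ∈ T.nodes → Concept.all R C ∈ T.label x → ¬ T.IndirectlyBlocked x →
      y ∈ T.nbrs H R x → C ∉ T.label y →
      NonGen H T (T.addConcepts y {C})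
  | all_plus_rule (x y : List ℕ) (R S : Role NR) (C : Concept NC NR) :
      x ∈ T.nodes → Concept.all S C ∈ T.label x → ¬ T.IndirectlyBlocked x →
      H.Trans R → H.Sub R S →
      y ∈ T.nbrs H R x → Concept.all R C ∉ T.label y →
      NonGen H T (T.addConcepts y {Concept.all R C})
  | choose_rule (x y : List ℕ) (R : Role NR) (B C E : Concept NC NR) :
      x ∈ T.nodes → B ∈ T.label x → B.box = some (R, C) → ¬ T.IndirectlyBlocked x →
      y ∈ T.nbrs H R x → C ∉ T.label y → C.compl ∉ T.label y → (E = C ∨ E = C.compl) →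
      NonGen H T (T.addConcepts y {E})
  | atMost_rule (x y z : List ℕ) (n : ℕ) (R : Role NR) (C : Concept NC NR) :
      x ∈ T.nodes → Concept.atMost n R C ∈ T.label x → ¬ T.IndirectlyBlocked x →
      n < (T.nbrsWith H R x C).card →
      y ∈ T.nbrsWith H R x C → z ∈ T.nbrsWith H R x C → y ≠ z →
      Disjoint (T.edgeBetween x y) (T.edgeBetween x z) → ¬ IsSucc x y →
      NonGen H T (T.merge x y z)

/-- The applications of the generating rules. -/
inductive Gen (H : Hierarchy NR) (T : CTree NC NR) : CTree NC NR → Prop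
  | ex_rule (x y : List ℕ) (R : Role NR) (C : Concept NC NR) :
      x ∈ T.nodes → Concept.ex R C ∈ T.label x → ¬ T.Blocked x →
      T.nbrsWith H R x C = ∅ →
      IsSucc y x → y ∉ T.nodes → Gen H T (T.addNode y R C)
  | atLeast_rule (x y : List ℕ) (n : ℕ) (R : Role NR) (C : Concept NC NR) :
      x ∈ T.nodes → Concept.atLeast n R C ∈ T.label x → ¬ T.Blocked x →
      (T.nbrsWith H R x C).card < n →
      IsSucc y x → y ∉ T.nodes → Gen H T (T.addNode y R C)
  | M_rule (x y : List ℕ) (r : ℚ) (R : Role NR) (C : Concept NC NR) :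
      x ∈ T.nodes → Concept.M r R C ∈ T.label x → ¬ T.Blocked x →
      ((T.nbrsWith H R x C).card : ℚ) ≤ r * (T.nbrs H R x).card →
      (T.nbrs H R x).card < T.BAN H x →
      IsSucc y x → y ∉ T.nodes → Gen H T (T.addNode y R C)
  | W_rule (x y : List ℕ) (r : ℚ) (R : Role NR) (C : Concept NC NR) :
      x ∈ T.nodes → Concept.W r R C ∈ T.label x → ¬ T.Blocked x →
      r * (T.nbrs H R x).card < ((T.nbrsWith H R x C.compl).card : ℚ) →
      (T.nbrs H R x).card < T.BAN H x →
      IsSucc y x → y ∉ T.nodes → Gen H T (T.addNode y R C)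

/-- One step of the algorithm: a generating rule is applied only if no non-generating rule is
applicable. -/
def Step (H : Hierarchy NR) (T T' : CTree NC NR) : Prop :=
  NonGen H T T' ∨ ((¬ ∃ T'', NonGen H T T'') ∧ Gen H T T')

/-- `t 0, …, t m` is a run of the algorithm with `m` rule applications, for the concept `D`
(in negation normal form). -/
def IsRun (H : Hierarchy NR) (D : Concept NC NR) (m : ℕ) (t : ℕ → CTree NC NR) : Prop :=
  t 0 = init D ∧ ∀ i < m, Step H (t i) (t (i + 1))

end CTree

end ALCQPIH

/-!
All concepts and roles that occur in a generated tree belong to two finite sets determined by `D`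
and the hierarchy. On a path of unblocked nodes the triples (label of the node, label of its
predecessor, label of the edge between them) are pairwise distinct, so there are at most as many
such nodes as triples; as every node that gets a successor is unblocked, this bounds the depth.

For the out-degree, unfold the recursion for the number `N_R`: each part role contributes at most a
factor given by its cluster, so that `BAN_x` is at most `n̄` times a power of two whose exponent is
linear in the length of `D`. Hence every concept `⊠ R.C` asks for a bounded number of
neighbours labelled with `C` and linked by `R`. Merging never destroys such a link, because two
nodes are merged only if the labels of the edges leading to them are disjoint, and each new
successor creates one; so the successors of a node can be counted by its links.

For termination, count the nodes, the concepts in their labels and the roles on the edges, where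
the empty label of an edge to a node that has been merged away counts more than any nonempty label.
Every rule application increases this number, which is bounded because the tree is.
-/

namespace ALCQPIH

/-! ### Sums over unions -/

theorem sum_union_le_add {α : Type*} (f : α → ℕ) (s t : Finset α) :
    ∑ a ∈ s ∪ t, f a ≤ ∑ a ∈ s, f a + ∑ a ∈ t, f a := by
  rw [← Finset.sum_union_inter]
  exact Nat.le_add_right _ _

theorem sum_biUnion_le_sum {ι α : Type*} (f : α → ℕ) (s : Finset ι) (t : ι → Finset α) :
    ∑ a ∈ s.biUnion t, f a ≤ ∑ i ∈ s, ∑ a ∈ t i, f a := by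
  induction s using Finset.induction_on with
  | empty => simp
  | insert i s hi ih =>
    rw [Finset.biUnion_insert, Finset.sum_insert hi]
    exact (sum_union_le_add f _ _).trans (Nat.add_le_add_left ih _)

/-! ### Roles -/

variable {NC : Type u} {NR : Type v}

theorem Role.inv_inv (R : Role NR) : R.Inv.Inv = R := by cases R <;> rfl

theorem Role.inv_ne_self (R : Role NR) : R.Inv ≠ R := by cases R <;> simp [Role.Inv]

theorem Hierarchy.SSub.mem_roles {H : Hierarchy NR} {R S : Role NR} (h : H.SSub R S) :
    R ∈ H.roles := by
  rcases Relation.ReflTransGen.cases_head h.1 with rfl | ⟨P, hRP | hRP, -⟩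
  · exact absurd rfl h.2
  · exact Finset.mem_union_left _ (Finset.mem_union_left _ (Finset.mem_image_of_mem _ hRP))
  · refine Finset.mem_union_right _ (Finset.mem_image.2 ⟨R.Inv, ?_, R.inv_inv⟩)
    exact Finset.mem_union_left _ (Finset.mem_image_of_mem Prod.fst hRP)

namespace Concept

/-! ### Negation normal form -/

/-- Negation normal form: negation occurs only in front of concept names. -/
def IsNNF : Concept NC NR → Prop
  | atom _ => True
  | neg C => ∃ a, C = atom a
  | and C D => C.IsNNF ∧ D.IsNNF
  | or C D => C.IsNNF ∧ D.IsNNF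
  | all _ C => C.IsNNF
  | ex _ C => C.IsNNF
  | atLeast _ _ C => C.IsNNF
  | atMost _ _ C => C.IsNNF
  | M _ _ C => C.IsNNF
  | W _ _ C => C.IsNNF

theorem isNNF_nnfAux (b : Bool) (C : Concept NC NR) : (nnfAux b C).IsNNF := by
  induction C generalizing b with
  | atLeast n R C ih =>
    cases b
    · cases n <;> simp [nnfAux, IsNNF, ih]
    · simp [nnfAux, IsNNF, ih]
  | _ => cases b <;> simp [nnfAux, IsNNF, *]

theorem isNNF_nnf (C : Concept NC NR) : C.nnf.IsNNF := isNNF_nnfAux true C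

theorem isNNF_compl (C : Concept NC NR) : C.compl.IsNNF := isNNF_nnfAux false C

theorem IsNNF.nnf_eq {C : Concept NC NR} (h : C.IsNNF) : C.nnf = C := by
  unfold nnf
  induction C with
  | neg C => obtain ⟨a, rfl⟩ := h; simp [nnfAux]
  | _ => simp_all [IsNNF, nnfAux]

@[simp] theorem nnf_atom (a : NC) : (atom a : Concept NC NR).nnf = atom a := by
  simp [nnf, nnfAux]

@[simp] theorem compl_atom (a : NC) : (atom a : Concept NC NR).compl = neg (atom a) := by
  simp [compl, nnfAux]

@[simp] theorem compl_neg (C : Concept NC NR) : (neg C).compl = C.nnf := by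
  simp [compl, nnf, nnfAux]

@[simp] theorem compl_and (C D : Concept NC NR) : (and C D).compl = or C.compl D.compl := by
  simp [compl, nnfAux]

@[simp] theorem compl_or (C D : Concept NC NR) : (or C D).compl = and C.compl D.compl := by
  simp [compl, nnfAux]

@[simp] theorem compl_all (R : Role NR) (C : Concept NC NR) : (all R C).compl = ex R C.compl := by
  simp [compl, nnfAux]

@[simp] theorem compl_ex (R : Role NR) (C : Concept NC NR) : (ex R C).compl = all R C.compl := by
  simp [compl, nnfAux]

@[simp] theorem compl_atLeast_zero (R : Role NR) (C : Concept NC NR) :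
    (atLeast 0 R C).compl = and (atom C.firstName) (neg (atom C.firstName)) := by
  simp [compl, nnfAux]

@[simp] theorem compl_atLeast_succ (n : ℕ) (R : Role NR) (C : Concept NC NR) :
    (atLeast (n + 1) R C).compl = atMost n R C.nnf := by
  simp [compl, nnf, nnfAux]

@[simp] theorem compl_atMost (n : ℕ) (R : Role NR) (C : Concept NC NR) :
    (atMost n R C).compl = atLeast (n + 1) R C.nnf := by
  simp [compl, nnf, nnfAux]

@[simp] theorem compl_M (r : ℚ) (R : Role NR) (C : Concept NC NR) :
    (M r R C).compl = W r R C.compl := by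
  simp [compl, nnfAux]

@[simp] theorem compl_W (r : ℚ) (R : Role NR) (C : Concept NC NR) :
    (W r R C).compl = M r R C.compl := by
  simp [compl, nnfAux]

/-- Double complementation need not be the identity: `∼∼(≥ 0 R.C)` is `¬A ⊔ A`. -/
theorem IsNNF.compl_compl_compl {C : Concept NC NR} (h : C.IsNNF) :
    C.compl.compl.compl = C.compl := by
  induction C with
  | neg C => obtain ⟨a, rfl⟩ := h; simp
  | atLeast n R C => cases n <;> simp_all [IsNNF, IsNNF.nnf_eq]
  | _ => simp_all [IsNNF, IsNNF.nnf_eq]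

/-! ### Subconcepts -/

/-- The immediate constituents of a concept. -/
noncomputable def parts : Concept NC NR → Finset (Concept NC NR)
  | atom _ => ∅
  | neg C => {C}
  | and C D => {C, D}
  | or C D => {C, D}
  | all _ C => {C}
  | ex _ C => {C}
  | atLeast _ _ C => {C}
  | atMost _ _ C => {C}
  | M _ _ C => {C}
  | W _ _ C => {C}

/-- The set of the subconcepts of a concept, including the concept itself. -/
noncomputable def subs : Concept NC NR → Finset (Concept NC NR)
  | atom a => {atom a}
  | neg C => {neg C} ∪ C.subs
  | and C D => {and C D} ∪ C.subs ∪ D.subs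
  | or C D => {or C D} ∪ C.subs ∪ D.subs
  | all R C => {all R C} ∪ C.subs
  | ex R C => {ex R C} ∪ C.subs
  | atLeast n R C => {atLeast n R C} ∪ C.subs
  | atMost n R C => {atMost n R C} ∪ C.subs
  | M r R C => {M r R C} ∪ C.subs
  | W r R C => {W r R C} ∪ C.subs

theorem self_mem_subs (C : Concept NC NR) : C ∈ C.subs := by
  cases C <;> simp [subs]

theorem atom_firstName_mem_subs (C : Concept NC NR) : atom C.firstName ∈ C.subs := by
  induction C <;> simp_all [subs, firstName]

theorem of_mem_subs {p : Concept NC NR → Prop} (hp : ∀ C, p C → ∀ P ∈ C.parts, p P)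
    {C D : Concept NC NR} (hD : p D) (hC : C ∈ D.subs) : p C := by
  induction D with
  | atom a => simp_all [subs]
  | and A B ihA ihB | or A B ihA ihB =>
    simp only [subs, Finset.mem_union, Finset.mem_singleton] at hC
    rcases hC with (rfl | hC) | hC
    · exact hD
    · exact ihA (hp _ hD A (by simp [parts])) hC
    · exact ihB (hp _ hD B (by simp [parts])) hC
  | _ =>
    rename_i A ih
    simp only [subs, Finset.mem_union, Finset.mem_singleton] at hC
    rcases hC with rfl | hC
    · exact hD
    · exact ih (hp _ hD A (by simp [parts])) hC

theorem subs_subset_of_mem_parts {C P : Concept NC NR} (hP : P ∈ C.parts) : P.subs ⊆ C.subs := by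
  cases C <;> grind [parts, subs]

theorem subs_subset {C D : Concept NC NR} (hC : C ∈ D.subs) : C.subs ⊆ D.subs :=
  of_mem_subs (p := fun E => E.subs ⊆ D.subs)
    (fun _ hE _ hP => (subs_subset_of_mem_parts hP).trans hE) subset_rfl hC

theorem IsNNF.of_mem_parts {C P : Concept NC NR} (hC : C.IsNNF) (hP : P ∈ C.parts) : P.IsNNF := by
  cases C with
  | neg C => obtain ⟨a, rfl⟩ := hC; grind [parts, IsNNF]
  | _ => grind [parts, IsNNF]

theorem IsNNF.of_mem_subs {C D : Concept NC NR} (hD : D.IsNNF) (hC : C ∈ D.subs) : C.IsNNF :=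
  Concept.of_mem_subs (p := IsNNF) (fun _ hE _ => hE.of_mem_parts) hD hC

theorem occRoles_subset_of_mem_parts {C P : Concept NC NR} (hP : P ∈ C.parts) :
    P.occRoles ⊆ C.occRoles := by
  cases C <;> grind [parts, occRoles]

theorem occRoles_subset {C D : Concept NC NR} (hC : C ∈ D.subs) : C.occRoles ⊆ D.occRoles :=
  of_mem_subs (p := fun E => E.occRoles ⊆ D.occRoles)
    (fun _ hE _ hP => (occRoles_subset_of_mem_parts hP).trans hE) subset_rfl hC

theorem exists_eq_nnfAux_of_mem_parts_nnfAux {b : Bool} {E X : Concept NC NR}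
    (hX : X ∈ (nnfAux b E).parts) : ∃ F ∈ E.subs, ∃ b', X = nnfAux b' F := by
  induction E generalizing b with
  | atom a =>
    cases b
    · exact ⟨atom a, self_mem_subs _, true, by simpa [nnfAux, parts] using hX⟩
    · simp_all [nnfAux, parts]
  | neg C ih =>
    obtain ⟨F, hF, b', rfl⟩ := ih (b := !b) (by simpa [nnfAux] using hX)
    exact ⟨F, subs_subset_of_mem_parts (by simp [parts]) hF, b', rfl⟩
  | atLeast n R C =>
    have hatom : atom C.firstName ∈ (atLeast n R C).subs := atom_firstName_mem_subs (atLeast n R C)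
    cases b
    · cases n
      · obtain rfl | rfl : X = atom C.firstName ∨ X = neg (atom C.firstName) := by
          simpa [nnfAux, parts] using hX
        · exact ⟨_, hatom, true, by simp [nnfAux]⟩
        · exact ⟨_, hatom, false, by simp [nnfAux]⟩
      · grind [nnfAux, parts, subs, self_mem_subs]
    · grind [nnfAux, parts, subs, self_mem_subs]
  | _ => cases b <;> grind [nnfAux, parts, subs, self_mem_subs]

theorem exists_eq_nnfAux_of_mem_subs_nnfAux {b : Bool} {E X : Concept NC NR}
    (hX : X ∈ (nnfAux b E).subs) : ∃ F ∈ E.subs, ∃ b', X = nnfAux b' F := by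
  refine of_mem_subs (p := fun X => ∃ F ∈ E.subs, ∃ b', X = nnfAux b' F) ?_
    ⟨E, self_mem_subs E, b, rfl⟩ hX
  rintro _ ⟨F, hF, b', rfl⟩ P hP
  obtain ⟨G, hG, hPG⟩ := exists_eq_nnfAux_of_mem_parts_nnfAux hP
  exact ⟨G, subs_subset hF hG, hPG⟩

/-! ### The concepts that can occur in a label -/

/-- The subconcepts of `D`, their complements, and the complements of those. -/
noncomputable def complSubs (D : Concept NC NR) : Finset (Concept NC NR) :=
  D.subs.biUnion fun E => {E, E.compl, E.compl.compl}

theorem mem_complSubs {C D : Concept NC NR} :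
    C ∈ D.complSubs ↔ ∃ E ∈ D.subs, C = E ∨ C = E.compl ∨ C = E.compl.compl := by
  simp [complSubs]

theorem self_mem_complSubs (D : Concept NC NR) : D ∈ D.complSubs :=
  mem_complSubs.2 ⟨D, self_mem_subs D, Or.inl rfl⟩

theorem IsNNF.mem_complSubs_iff {C D : Concept NC NR} (hD : D.IsNNF) :
    C ∈ D.complSubs ↔ ∃ E ∈ D.subs, ∃ b b', C = nnfAux b (nnfAux b' E) := by
  refine mem_complSubs.trans (exists_congr fun E => and_congr_right fun hE => ?_)
  have hE' : nnfAux true E = E := (hD.of_mem_subs hE).nnf_eq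
  have hEc : nnfAux true E.compl = E.compl := (isNNF_compl E).nnf_eq
  simp only [compl] at hEc
  simp only [Bool.exists_bool, hE', hEc, compl]
  tauto

theorem IsNNF.parts_subset_complSubs {C D : Concept NC NR} (hD : D.IsNNF)
    (hC : C ∈ D.complSubs) : C.parts ⊆ D.complSubs := by
  intro P hP
  obtain ⟨E, hE, b, b', rfl⟩ := hD.mem_complSubs_iff.1 hC
  obtain ⟨G, hG, c, rfl⟩ := exists_eq_nnfAux_of_mem_parts_nnfAux hP
  obtain ⟨F, hF, c', rfl⟩ := exists_eq_nnfAux_of_mem_subs_nnfAux hG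
  exact hD.mem_complSubs_iff.2 ⟨F, subs_subset hE hF, c, c', rfl⟩

theorem IsNNF.compl_mem_complSubs {C D : Concept NC NR} (hD : D.IsNNF) (hC : C ∈ D.complSubs) :
    C.compl ∈ D.complSubs := by
  obtain ⟨E, hE, rfl | rfl | rfl⟩ := mem_complSubs.1 hC
  · exact mem_complSubs.2 ⟨C, hE, Or.inr (Or.inl rfl)⟩
  · exact mem_complSubs.2 ⟨E, hE, Or.inr (Or.inr rfl)⟩
  · exact mem_complSubs.2 ⟨E, hE, Or.inr (Or.inl (hD.of_mem_subs hE).compl_compl_compl)⟩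

theorem IsNNF.exists_le_of_mem_complSubs {α : Type*} [Preorder α] {f : Concept NC NR → α}
    (hf : ∀ E : Concept NC NR, E.IsNNF → f E.compl ≤ f E) {C D : Concept NC NR} (hD : D.IsNNF)
    (hC : C ∈ D.complSubs) : ∃ E ∈ D.subs, f C ≤ f E := by
  obtain ⟨E, hE, rfl | rfl | rfl⟩ := mem_complSubs.1 hC
  · exact ⟨C, hE, le_rfl⟩
  · exact ⟨E, hE, hf E (hD.of_mem_subs hE)⟩
  · exact ⟨E, hE, (hf _ (isNNF_compl E)).trans (hf E (hD.of_mem_subs hE))⟩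

theorem IsNNF.sum_complSubs_le {f : Concept NC NR → ℕ}
    (hf : ∀ E : Concept NC NR, E.IsNNF → f E.compl ≤ f E) {D : Concept NC NR} (hD : D.IsNNF) :
    ∑ C ∈ D.complSubs, f C ≤ 3 * ∑ E ∈ D.subs, f E := by
  rw [Finset.mul_sum]
  refine (sum_biUnion_le_sum f _ _).trans (Finset.sum_le_sum fun E hE => ?_)
  have hcompl := hf E (hD.of_mem_subs hE)
  have hcompl' := hf _ (isNNF_compl E)
  refine (Finset.sum_le_card_nsmul _ _ (f E) fun C hC => ?_).trans
    (Nat.mul_le_mul_right _ Finset.card_le_three)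
  simp only [Finset.mem_insert, Finset.mem_singleton] at hC
  rcases hC with rfl | rfl | rfl
  exacts [le_rfl, hcompl, hcompl'.trans hcompl]

theorem card_complSubs_le (D : Concept NC NR) : D.complSubs.card ≤ 3 * D.subs.card := by
  rw [mul_comm]
  exact Finset.card_biUnion_le_card_mul _ _ 3 fun E _ => Finset.card_le_three

theorem IsNNF.occRoles_compl_subset {E : Concept NC NR} (hE : E.IsNNF) :
    E.compl.occRoles ⊆ E.occRoles := by
  induction E with
  | neg C => obtain ⟨a, rfl⟩ := hE; simp [occRoles]
  | atLeast n R C => cases n <;> simp_all [IsNNF, IsNNF.nnf_eq, occRoles]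
  | atMost n R C => simp_all [IsNNF, IsNNF.nnf_eq, occRoles]
  | _ =>
    grind [IsNNF, occRoles, compl_atom, compl_and, compl_or, compl_all, compl_ex, compl_M,
      compl_W]

theorem IsNNF.occRoles_subset_of_mem_complSubs {C D : Concept NC NR} (hD : D.IsNNF)
    (hC : C ∈ D.complSubs) : C.occRoles ⊆ D.occRoles := by
  obtain ⟨E, hE, hCE⟩ :=
    hD.exists_le_of_mem_complSubs (f := occRoles) (fun _ h => h.occRoles_compl_subset) hC
  exact hCE.trans (occRoles_subset hE)

/-- The set `{C}` for a concept `∀ R.C`, and `∅` for other concepts. -/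
def allBody : Concept NC NR → Finset (Concept NC NR)
  | all _ C => {C}
  | _ => ∅

theorem allBody_subset_parts (C : Concept NC NR) : C.allBody ⊆ C.parts := by
  cases C <;> simp [allBody, parts]

/-- The concepts that the algorithm, started with `D`, can add to a label: besides the concepts of
`complSubs D`, the `∀₊`-rule produces concepts `∀ R.C` in which only the role `R` is new. -/
noncomputable def closure (D : Concept NC NR) (H : Hierarchy NR) : Finset (Concept NC NR) :=
  D.complSubs ∪
    (D.rolesWith H ×ˢ D.complSubs.biUnion allBody).image fun p => all p.1 p.2

theorem mem_closure {C D : Concept NC NR} {H : Hierarchy NR} :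
    C ∈ D.closure H ↔ C ∈ D.complSubs ∨
      ∃ R ∈ D.rolesWith H, ∃ B ∈ D.complSubs.biUnion allBody, C = all R B := by
  simp only [closure, Finset.mem_union, Finset.mem_image, Finset.mem_product, Prod.exists]
  grind

theorem self_mem_closure (D : Concept NC NR) (H : Hierarchy NR) : D ∈ D.closure H :=
  mem_closure.2 (Or.inl (self_mem_complSubs D))

theorem IsNNF.parts_subset_closure {C D : Concept NC NR} {H : Hierarchy NR} (hD : D.IsNNF)
    (hC : C ∈ D.closure H) : C.parts ⊆ D.closure H := by
  intro P hP
  refine mem_closure.2 (Or.inl ?_)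
  rcases mem_closure.1 hC with hC | ⟨R, -, B, hB, rfl⟩
  · exact hD.parts_subset_complSubs hC hP
  · obtain ⟨E, hE, hBE⟩ := Finset.mem_biUnion.1 hB
    obtain rfl : P = B := by simpa [parts] using hP
    exact hD.parts_subset_complSubs hE (E.allBody_subset_parts hBE)

theorem all_mem_closure_of_sub {C D : Concept NC NR} {H : Hierarchy NR} {R S : Role NR}
    (h : all S C ∈ D.closure H) (hRS : H.Sub R S) : all R C ∈ D.closure H := by
  by_cases hne : R = S
  · rwa [hne]
  have hR : R ∈ D.rolesWith H := Finset.mem_union_right _ (Hierarchy.SSub.mem_roles ⟨hRS, hne⟩)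
  refine mem_closure.2 (Or.inr ⟨R, hR, C, ?_, rfl⟩)
  rcases mem_closure.1 h with h | ⟨_, -, B, hB, heq⟩
  · exact Finset.mem_biUnion.2 ⟨_, h, by simp [allBody]⟩
  · injection heq with _ hCB
    rwa [hCB]

section Box

variable {B C D : Concept NC NR} {H : Hierarchy NR} {R : Role NR}

theorem mem_parts_of_box (h : B.box = some (R, C)) : C ∈ B.parts := by
  cases B <;> simp_all [box, parts]

theorem mem_occRoles_of_box (h : B.box = some (R, C)) : R ∈ B.occRoles := by
  cases B <;> simp_all [box, occRoles]

theorem mem_complSubs_of_box (hB : B ∈ D.closure H) (h : B.box = some (R, C)) :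
    B ∈ D.complSubs := by
  rcases mem_closure.1 hB with hB | ⟨S, -, E, -, rfl⟩
  · exact hB
  · simp [box] at h

theorem IsNNF.mem_closure_of_box (hD : D.IsNNF) (hB : B ∈ D.closure H)
    (h : B.box = some (R, C)) : C ∈ D.closure H :=
  hD.parts_subset_closure hB (mem_parts_of_box h)

theorem IsNNF.compl_mem_closure_of_box (hD : D.IsNNF) (hB : B ∈ D.closure H)
    (h : B.box = some (R, C)) : C.compl ∈ D.closure H :=
  mem_closure.2 (Or.inl (hD.compl_mem_complSubs
    (hD.parts_subset_complSubs (mem_complSubs_of_box hB h) (mem_parts_of_box h))))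

theorem IsNNF.mem_rolesWith_of_box (hD : D.IsNNF) (hB : B ∈ D.closure H)
    (h : B.box = some (R, C)) : R ∈ D.rolesWith H :=
  Finset.mem_union_left _ (Finset.mem_union_left _
    (hD.occRoles_subset_of_mem_complSubs (mem_complSubs_of_box hB h) (mem_occRoles_of_box h)))

theorem inv_mem_rolesWith (h : R ∈ D.rolesWith H) : R.Inv ∈ D.rolesWith H := by
  simp only [rolesWith, Hierarchy.roles, Finset.mem_union, Finset.mem_image] at h ⊢
  rcases h with (h | ⟨S, h, rfl⟩) | h | ⟨S, h, rfl⟩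
  · exact Or.inl (Or.inr ⟨R, h, rfl⟩)
  · exact Or.inl (Or.inl (by rwa [Role.inv_inv]))
  · exact Or.inr (Or.inr ⟨R, h, rfl⟩)
  · exact Or.inr (Or.inl (by rwa [Role.inv_inv]))

theorem two_le_card_rolesWith (h : R ∈ D.rolesWith H) : 2 ≤ (D.rolesWith H).card :=
  Finset.one_lt_card.2 ⟨R.Inv, inv_mem_rolesWith h, R, h, R.inv_ne_self⟩

theorem supers_subset_rolesWith (h : R ∈ D.rolesWith H) : H.supers R ⊆ D.rolesWith H :=
  Finset.insert_subset h ((Finset.filter_subset _ _).trans Finset.subset_union_right)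

end Box

/-! ### Counting symbols -/

/-- The number of symbols at the uppermost level of a concept. -/
def headLength : Concept NC NR → ℕ
  | atom _ => 1
  | neg _ => 1
  | and _ _ => 1
  | or _ _ => 1
  | all _ _ => 2
  | ex _ _ => 2
  | atLeast n _ _ => 2 + numLength n
  | atMost n _ _ => 2 + numLength n
  | M r _ _ => 2 + numLength r.num.natAbs + numLength r.den
  | W r _ _ => 2 + numLength r.num.natAbs + numLength r.den

theorem sum_headLength_subs_le (C : Concept NC NR) :
    ∑ E ∈ C.subs, E.headLength ≤ C.length := by
  induction C with
  | atom a => simp [subs, headLength, length]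
  | and A B ihA ihB | or A B ihA ihB =>
    simp only [subs, length]
    refine (sum_union_le_add _ _ _).trans (add_le_add ((sum_union_le_add _ _ _).trans ?_) ihB)
    simpa [headLength] using ihA
  | _ =>
    rename_i ih
    simp only [subs, length]
    refine (sum_union_le_add _ _ _).trans (add_le_add ?_ ih)
    simp only [Finset.sum_singleton, headLength, le_refl]

/-- `1` for a quantified concept `∀ R.C` or `∃ R.C`, and `0` for other concepts. -/
def isQuant : Concept NC NR → ℕ
  | all _ _ => 1
  | ex _ _ => 1
  | _ => 0

/-- The number of the quantified subconcepts `∀ R.C` and `∃ R.C` of a concept. -/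
noncomputable def numQuant (D : Concept NC NR) : ℕ := ∑ E ∈ D.subs, E.isQuant

theorem card_subs_add_numQuant_le (D : Concept NC NR) : D.subs.card + D.numQuant ≤ D.length := by
  rw [numQuant, Finset.card_eq_sum_ones, ← Finset.sum_add_distrib]
  refine le_trans (Finset.sum_le_sum fun E _ => ?_) (sum_headLength_subs_le D)
  cases E <;> simp only [isQuant, headLength] <;> omega

theorem two_mul_numQuant_lt (D : Concept NC NR) : 2 * D.numQuant < D.length := by
  rw [numQuant, Finset.mul_sum]
  refine (Finset.sum_lt_sum (fun E _ => ?_) ⟨_, atom_firstName_mem_subs D, ?_⟩).trans_le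
    (sum_headLength_subs_le D)
  · cases E <;> simp only [isQuant, headLength] <;> omega
  · simp [isQuant, headLength]

theorem IsNNF.card_biUnion_allBody_le {E : Concept NC NR} (hE : E.IsNNF) :
    (({E, E.compl, E.compl.compl} : Finset (Concept NC NR)).biUnion allBody).card ≤
      2 * E.isQuant := by
  cases E with
  | neg C => obtain ⟨a, rfl⟩ := hE; simp [allBody]
  | all R C =>
    simpa [allBody, isQuant, Finset.biUnion_insert] using
      (Finset.card_le_two : ({C, C.compl.compl} : Finset (Concept NC NR)).card ≤ 2)
  | atLeast n R C => cases n <;> simp [allBody]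
  | _ => simp [allBody, isQuant]

theorem IsNNF.card_allBody_complSubs_le {D : Concept NC NR} (hD : D.IsNNF) :
    (D.complSubs.biUnion allBody).card ≤ 2 * D.numQuant := by
  rw [complSubs, Finset.biUnion_biUnion, numQuant, Finset.mul_sum]
  exact Finset.card_biUnion_le.trans
    (Finset.sum_le_sum fun E hE => (hD.of_mem_subs hE).card_biUnion_allBody_le)

theorem IsNNF.card_closure_le {D : Concept NC NR} (hD : D.IsNNF) (H : Hierarchy NR) :
    (D.closure H).card ≤ 3 * D.subs.card + (D.rolesWith H).card * (2 * D.numQuant) := by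
  refine (Finset.card_union_le _ _).trans
    (add_le_add D.card_complSubs_le (Finset.card_image_le.trans ?_))
  rw [Finset.card_product]
  exact Nat.mul_le_mul_left _ hD.card_allBody_complSubs_le

/-! ### Weights of number and part restrictions -/

theorem lt_two_pow_numLength (n : ℕ) : n < 2 ^ numLength n :=
  (Nat.lt_size_self n).trans_le (Nat.pow_le_pow_right two_pos (le_max_right _ _))

/-- One more than the length of the denominator of the index of a part restriction, and `0` for
other concepts. Satisfaction numbers are bounded by powers of two with sums of these weights as
exponents. -/
def partWeight : Concept NC NR → ℕ
  | M r _ _ => 1 + numLength r.den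
  | W r _ _ => 1 + numLength r.den
  | _ => 0

theorem two_mul_den_rbar_le {C : Concept NC NR} (h : C.partRole.isSome) :
    2 * C.rbar.den ≤ 2 ^ C.partWeight := by
  cases C with
  | M r R C =>
    simp only [rbar, partWeight, pow_add, pow_one]
    exact Nat.mul_le_mul_left _ (lt_two_pow_numLength _).le
  | W r R C =>
    simp only [rbar, partWeight, pow_add, pow_one]
    have hdvd : (1 - r).den ∣ r.den := by simp
    exact Nat.mul_le_mul_left _
      ((Nat.le_of_dvd r.den_pos hdvd).trans (lt_two_pow_numLength _).le)
  | _ => simp [partRole] at h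

theorem one_le_partWeight {C : Concept NC NR} (h : C.partRole.isSome) : 1 ≤ C.partWeight := by
  cases C <;> simp_all [partRole, partWeight]

theorem den_wIndex_le (C : Concept NC NR) : (C.wIndex.getD 0).den ≤ 2 ^ C.partWeight := by
  cases C with
  | W r R C =>
    simp only [wIndex, partWeight, Option.getD_some]
    exact (lt_two_pow_numLength _).le.trans
      (Nat.pow_le_pow_right two_pos (Nat.le_add_left _ _))
  | _ => simp [wIndex, Nat.one_le_two_pow]

theorem partWeight_le_headLength (C : Concept NC NR) : C.partWeight ≤ C.headLength := by
  cases C <;> simp only [partWeight, headLength] <;> omega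

theorem IsNNF.partWeight_compl_le {E : Concept NC NR} (hE : E.IsNNF) :
    E.compl.partWeight ≤ E.partWeight := by
  cases E with
  | neg C => obtain ⟨a, rfl⟩ := hE; simp [partWeight]
  | atLeast n R C => cases n <;> simp [partWeight]
  | _ => simp [partWeight]

theorem IsNNF.sum_partWeight_closure_le {D : Concept NC NR} (hD : D.IsNNF) (H : Hierarchy NR) :
    ∑ C ∈ D.closure H, C.partWeight ≤ 3 * D.length := by
  have hcompl : ∑ C ∈ D.closure H, C.partWeight ≤ ∑ C ∈ D.complSubs, C.partWeight := by
    refine Finset.sum_le_sum_of_ne_zero fun C hC hw => ?_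
    rcases mem_closure.1 hC with hC | ⟨R, -, B, -, rfl⟩
    exacts [hC, absurd rfl hw]
  refine hcompl.trans ((hD.sum_complSubs_le fun E hE => hE.partWeight_compl_le).trans ?_)
  exact Nat.mul_le_mul_left _
    ((Finset.sum_le_sum fun E _ => E.partWeight_le_headLength).trans D.sum_headLength_subs_le)

/-- A bound of the number of neighbours required by a concept or by its complement. -/
def numBound : Concept NC NR → ℕ
  | atLeast n _ _ => max n 1
  | atMost n _ _ => n + 1
  | _ => 1

theorem atLeastNum_exToAtLeast_le (C : Concept NC NR) :
    C.exToAtLeast.atLeastNum ≤ C.numBound := by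
  cases C <;> simp [exToAtLeast, atLeastNum, numBound]

theorem IsNNF.numBound_compl_le {E : Concept NC NR} (hE : E.IsNNF) :
    E.compl.numBound ≤ E.numBound := by
  cases E with
  | neg C => obtain ⟨a, rfl⟩ := hE; simp [numBound]
  | atLeast n R C => cases n <;> simp [numBound]
  | _ => simp [numBound]

theorem numBound_le (C : Concept NC NR) : C.numBound ≤ 2 ^ C.headLength := by
  cases C with
  | atLeast n R C | atMost n R C =>
    have hn := lt_two_pow_numLength n
    simp only [numBound, headLength, pow_add]
    omega
  | _ => simpa [numBound] using Nat.one_le_two_pow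

theorem headLength_le_of_mem_subs {C D : Concept NC NR} (hC : C ∈ D.subs) :
    C.headLength ≤ D.length :=
  (Finset.single_le_sum (fun _ _ => Nat.zero_le _) hC).trans D.sum_headLength_subs_le

theorem IsNNF.atLeastNum_le_of_mem_closure {C D : Concept NC NR} {H : Hierarchy NR}
    (hD : D.IsNNF) (hC : C ∈ D.closure H) : C.exToAtLeast.atLeastNum ≤ 2 ^ D.length := by
  rcases mem_closure.1 hC with hC | ⟨R, -, B, -, rfl⟩
  · obtain ⟨E, hE, hCE⟩ :=
      hD.exists_le_of_mem_complSubs (f := numBound) (fun _ h => h.numBound_compl_le) hC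
    calc C.exToAtLeast.atLeastNum ≤ C.numBound := C.atLeastNum_exToAtLeast_le
      _ ≤ E.numBound := hCE
      _ ≤ 2 ^ E.headLength := E.numBound_le
      _ ≤ 2 ^ D.length := Nat.pow_le_pow_right two_pos (headLength_le_of_mem_subs hE)
  · simp [exToAtLeast, atLeastNum]

end Concept

/-! ### Satisfaction numbers -/

theorem floor_div_le_mul_den (B : ℕ) {x : ℚ} (hx : 0 < x) : ⌊(B : ℚ) / x⌋₊ ≤ B * x.den := by
  have hnum : (1 : ℚ) ≤ x.num := by exact_mod_cast Rat.num_pos.2 hx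
  refine Nat.floor_le_of_le ((div_le_iff₀ hx).2 ?_)
  calc (B : ℚ) ≤ B * x.num := le_mul_of_one_le_right (Nat.cast_nonneg _) hnum
    _ = (B * x.den : ℕ) * x := by rw [← Rat.mul_den_eq_num]; push_cast; ring

theorem floor_div_add_le (k : ℕ) {B X : ℕ} {x : ℚ} (hx : 0 < x) (hB : B ≤ X) (hX : 1 ≤ X) :
    ⌊(B : ℚ) / x⌋₊ + k ≤ X * (2 ^ k * x.den) := by
  have hk : k ≤ X * (k * x.den) :=
    (Nat.le_mul_of_pos_right _ x.den_pos).trans (Nat.le_mul_of_pos_left _ hX)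
  calc ⌊(B : ℚ) / x⌋₊ + k ≤ X * x.den + X * (k * x.den) :=
        add_le_add ((floor_div_le_mul_den B hx).trans (Nat.mul_le_mul_right _ hB)) hk
    _ = X * ((k + 1) * x.den) := by ring
    _ ≤ X * (2 ^ k * x.den) := by gcongr; exact k.lt_two_pow_self

theorem two_pow_card_mul_den_le {K : Finset (Concept NC NR)}
    (hK : ∀ C ∈ K, C.partRole.isSome) :
    2 ^ K.card * (1 - ∑ C ∈ K, C.rbar).den ≤ 2 ^ ∑ C ∈ K, C.partWeight := by
  have hdvd : (1 - ∑ C ∈ K, C.rbar).den ∣ ∏ C ∈ K, C.rbar.den := by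
    have hsub := Rat.sub_den_dvd 1 (∑ C ∈ K, C.rbar)
    rw [Rat.den_one, one_mul] at hsub
    exact hsub.trans (Finset.Rat.den_sum_dvd_prod_den _ _)
  calc 2 ^ K.card * (1 - ∑ C ∈ K, C.rbar).den ≤ 2 ^ K.card * ∏ C ∈ K, C.rbar.den :=
        Nat.mul_le_mul_left _ (Nat.le_of_dvd (Finset.prod_pos fun C _ => C.rbar.den_pos) hdvd)
    _ = ∏ C ∈ K, 2 * C.rbar.den := by rw [Finset.prod_mul_distrib, Finset.prod_const]
    _ ≤ ∏ C ∈ K, 2 ^ C.partWeight :=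
        Finset.prod_le_prod' fun C hC => Concept.two_mul_den_rbar_le (hK C hC)
    _ = 2 ^ ∑ C ∈ K, C.partWeight := Finset.prod_pow_eq_pow_sum _ _ _

/-- The factor by which the base number of `R` grows in the satisfaction number of `R`. -/
noncomputable def growth (L : Finset (Concept NC NR)) (R : Role NR) : ℕ :=
  2 ^ ∑ C ∈ cluster L R, C.partWeight

theorem clusterNum_le (L : Finset (Concept NC NR)) (R : Role NR) {B X : ℕ} (hB : B ≤ X)
    (hX : 1 ≤ X) : clusterNum (cluster L R) B ≤ X * growth L R := by
  unfold clusterNum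
  split_ifs
  · refine Finset.sup_le fun K hK => ?_
    obtain ⟨hKR, -, hlt⟩ := Finset.mem_filter.1 hK
    rw [Finset.mem_powerset] at hKR
    have hpart : ∀ C ∈ K, C.partRole.isSome := fun C hC => by
      rw [(Finset.mem_filter.1 (hKR hC)).2]; rfl
    refine (floor_div_add_le K.card (sub_pos.2 hlt) hB hX).trans (Nat.mul_le_mul_left _ ?_)
    exact (two_pow_card_mul_den_le hpart).trans
      (Nat.pow_le_pow_right two_pos (Finset.sum_le_sum_of_subset hKR))
  · exact Nat.mul_pos hX (Nat.two_pow_pos _)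

theorem sum_mul_prod_lt_le_prod_one_add {α : Type*} [PartialOrder α] (f : α → ℕ)
    (s : Finset α) :
    ∑ a ∈ s, f a * ∏ b ∈ s with b < a, (1 + f b) ≤ ∏ a ∈ s, (1 + f a) := by
  refine Finset.induction_on_max_value toLinearExtension s (by simp) fun a s ha hmax ih => ?_
  have hbelow : ∀ c ∈ s, ∏ b ∈ insert a s with b < c, (1 + f b) =
      ∏ b ∈ s with b < c, (1 + f b) := fun c hc => by
    have hac : ¬ a < c := fun h => h.ne
      ((toLinearExtension.monotone h.le).antisymm (hmax c hc))
    rw [Finset.filter_insert, if_neg hac]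
  have htop : ∏ b ∈ insert a s with b < a, (1 + f b) ≤ ∏ b ∈ s, (1 + f b) := by
    rw [Finset.filter_insert, if_neg (lt_irrefl a)]
    exact Finset.prod_le_prod_of_subset_of_one_le' (Finset.filter_subset _ _)
      fun _ _ _ => Nat.le_add_right _ _
  rw [Finset.sum_insert ha, Finset.prod_insert ha, one_add_mul, add_comm,
    Finset.sum_congr rfl fun c hc => by rw [hbelow c hc]]
  exact add_le_add ih (Nat.mul_le_mul_left _ htop)

/-- The order `⊑⁺` on the roles. -/
abbrev Hierarchy.partialOrder (H : Hierarchy NR) : PartialOrder (Role NR) where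
  le := H.Sub
  lt := H.SSub
  le_refl _ := Relation.ReflTransGen.refl
  le_trans _ _ _ := Relation.ReflTransGen.trans
  lt_iff_le_not_ge R S :=
    ⟨fun h => ⟨h.1, fun h' => h.2 (H.acyclic R S h.1 h')⟩,
      fun h => ⟨h.1, fun heq => h.2 (heq ▸ Relation.ReflTransGen.refl)⟩⟩
  le_antisymm := H.acyclic

theorem sum_directSubs_growth_le (H : Hierarchy NR) (L : Finset (Concept NC NR)) (R : Role NR) :
    ∑ S ∈ directSubs H L R, growth L S * ∏ P ∈ partRoles L with H.SSub P S, (1 + growth L P) ≤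
      ∏ S ∈ partRoles L with H.SSub S R, (1 + growth L S) := by
  let _ := H.partialOrder
  have hsub : directSubs H L R ⊆ (partRoles L).filter (H.SSub · R) :=
    Finset.monotone_filter_right _ fun _ _ h => h.1
  refine (Finset.sum_le_sum_of_subset hsub).trans (le_trans (Finset.sum_le_sum fun S hS => ?_)
    (sum_mul_prod_lt_le_prod_one_add (growth L) ((partRoles L).filter (H.SSub · R))))
  refine Nat.mul_le_mul_left _ (Finset.prod_le_prod_of_subset_of_one_le' (fun P hP => ?_)
    fun _ _ _ => Nat.le_add_right _ _)
  obtain ⟨hPL, hPS⟩ := Finset.mem_filter.1 hP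
  exact Finset.mem_filter.2
    ⟨Finset.mem_filter.2 ⟨hPL, hPS.trans (Finset.mem_filter.1 hS).2⟩, hPS⟩

theorem satNum_le (H : Hierarchy NR) (L : Finset (Concept NC NR)) {n X : ℕ} (hX : 1 ≤ X)
    (hn : n ≤ X) (R : Role NR) :
    satNum H L n R ≤
      X * (growth L R * ∏ S ∈ partRoles L with H.SSub S R, (1 + growth L S)) := by
  induction R using satNum.induct H L with
  | case1 R ih =>
    have hprod : 1 ≤ ∏ S ∈ partRoles L with H.SSub S R, (1 + growth L S) :=
      Finset.one_le_prod' fun _ _ => Nat.le_add_right _ _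
    rw [mul_comm (growth L R), ← mul_assoc, satNum]
    refine clusterNum_le L R ?_ (Nat.mul_pos hX hprod)
    split_ifs
    · exact hn.trans (Nat.le_mul_of_pos_right _ hprod)
    · rw [Finset.sum_attach (directSubs H L R) (satNum H L n)]
      have hsub : ∀ S ∈ directSubs H L R, satNum H L n S ≤
          X * (growth L S * ∏ P ∈ partRoles L with H.SSub P S, (1 + growth L P)) :=
        fun S hS => ih ⟨S, hS⟩
      refine (Finset.sum_le_sum hsub).trans ?_
      rw [← Finset.mul_sum]
      exact Nat.mul_le_mul_left _ (sum_directSubs_growth_le H L R)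

theorem one_add_growth_le {L : Finset (Concept NC NR)} {R : Role NR} (hR : R ∈ partRoles L) :
    1 + growth L R ≤ 2 ^ (2 * ∑ C ∈ cluster L R, C.partWeight) := by
  obtain ⟨C, hC, hCR⟩ : ∃ C ∈ L, C.partRole = some R := by simpa [partRoles] using hR
  have hweight : 1 ≤ ∑ C ∈ cluster L R, C.partWeight :=
    (C.one_le_partWeight (by rw [hCR]; rfl)).trans
      (Finset.single_le_sum (f := Concept.partWeight) (fun _ _ => Nat.zero_le _)
        (Finset.mem_filter.2 ⟨hC, hCR⟩))
  have hgrowth : 2 ≤ growth L R := Nat.pow_le_pow_right two_pos hweight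
  rw [mul_comm, pow_mul]
  change 1 + growth L R ≤ growth L R ^ 2
  nlinarith

theorem sum_partWeight_cluster_le (L : Finset (Concept NC NR)) :
    ∑ R ∈ partRoles L, ∑ C ∈ cluster L R, C.partWeight ≤ ∑ C ∈ L, C.partWeight := by
  rw [← Finset.sum_biUnion]
  · exact Finset.sum_le_sum_of_subset (Finset.biUnion_subset.2 fun R _ => Finset.filter_subset _ _)
  · intro R _ S _ hne
    refine Finset.disjoint_left.2 fun C hR hS => hne ?_
    exact Option.some_injective _ ((Finset.mem_filter.1 hR).2.symm.trans (Finset.mem_filter.1 hS).2)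

theorem banClusters_le (H : Hierarchy NR) (L : Finset (Concept NC NR)) {n X : ℕ} (hX : 1 ≤ X)
    (hn : n ≤ X) : banClusters H L n ≤ X * 2 ^ (2 * ∑ C ∈ L, C.partWeight) := by
  refine Finset.sup_le fun R hR => (satNum_le H L hX hn R).trans (Nat.mul_le_mul_left _ ?_)
  have hRL := (Finset.mem_filter.1 hR).1
  have hsub : (partRoles L).filter (H.SSub · R) ⊆ (partRoles L).erase R := fun S hS =>
    Finset.mem_erase.2 ⟨(Finset.mem_filter.1 hS).2.2, (Finset.mem_filter.1 hS).1⟩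
  calc growth L R * ∏ S ∈ partRoles L with H.SSub S R, (1 + growth L S)
      ≤ (1 + growth L R) * ∏ S ∈ (partRoles L).erase R, (1 + growth L S) :=
        Nat.mul_le_mul (Nat.le_add_left _ _) (Finset.prod_le_prod_of_subset_of_one_le' hsub
          fun _ _ _ => Nat.le_add_right _ _)
    _ = ∏ S ∈ partRoles L, (1 + growth L S) := Finset.mul_prod_erase _ (1 + growth L ·) hRL
    _ ≤ ∏ S ∈ partRoles L, 2 ^ (2 * ∑ C ∈ cluster L S, C.partWeight) :=
        Finset.prod_le_prod' fun _ => one_add_growth_le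
    _ ≤ 2 ^ (2 * ∑ C ∈ L, C.partWeight) := by
        rw [Finset.prod_pow_eq_pow_sum, ← Finset.mul_sum]
        exact Nat.pow_le_pow_right two_pos (Nat.mul_le_mul_left _ (sum_partWeight_cluster_le L))

theorem lcmOne_le (L : Finset (Concept NC NR)) : lcmOne L ≤ 2 ^ ∑ C ∈ L, C.partWeight :=
  calc lcmOne L ≤ ∏ C ∈ wOne L, (C.wIndex.getD 0).den :=
        Nat.le_of_dvd (Finset.prod_pos fun _ _ => Rat.den_pos _) (Finset.lcm_dvd_prod _ _)
    _ ≤ ∏ C ∈ wOne L, 2 ^ C.partWeight := Finset.prod_le_prod' fun _ _ => Concept.den_wIndex_le _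
    _ = 2 ^ ∑ C ∈ wOne L, C.partWeight := Finset.prod_pow_eq_pow_sum _ _ _
    _ ≤ 2 ^ ∑ C ∈ L, C.partWeight :=
        Nat.pow_le_pow_right two_pos (Finset.sum_le_sum_of_subset (Finset.filter_subset _ _))

/-! ### The border amount of neighbours -/

/-- A bound of the border amounts of neighbours in the trees generated for `D`. -/
noncomputable def Concept.banBound (D : Concept NC NR) (H : Hierarchy NR) : ℕ :=
  ((D.closure H).card * 2 ^ D.length + (D.rolesWith H).card * (D.closure H).card +
    2 ^ D.length) * 2 ^ (9 * D.length)

theorem Concept.two_pow_length_le_banBound (D : Concept NC NR) (H : Hierarchy NR) :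
    2 ^ D.length ≤ D.banBound H :=
  (Nat.le_add_left _ _).trans (Nat.le_mul_of_pos_right _ (Nat.two_pow_pos _))

namespace CTree

/-- The labels of `T` contain only concepts and roles that can arise from `D`. -/
structure IsOver (D : Concept NC NR) (H : Hierarchy NR) (T : CTree NC NR) : Prop where
  label_subset : ∀ x, T.label x ⊆ D.closure H
  edge_subset : ∀ x, T.edge x ⊆ D.rolesWith H

variable {D : Concept NC NR} {H : Hierarchy NR} {T : CTree NC NR}

theorem IsOver.sum_inherited_le (hT : IsOver D H T) (x : List ℕ) :
    ∑ C ∈ T.inherited H x, C.atLeastNum ≤ (D.rolesWith H).card * (D.closure H).card := by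
  cases x with
  | nil => simp [inherited]
  | cons i u =>
    refine (Finset.sum_image_le_of_nonneg fun _ _ => Nat.zero_le _).trans ?_
    simp only [Concept.atLeastNum, Finset.sum_const, smul_eq_mul, mul_one, Finset.card_product]
    have hsupers : (T.edge (i :: u)).biUnion H.supers ⊆ D.rolesWith H :=
      Finset.biUnion_subset.2 fun R hR =>
        Concept.supers_subset_rolesWith (hT.edge_subset _ hR)
    exact Nat.mul_le_mul (Finset.card_image_le.trans (Finset.card_le_card hsupers))
      (Finset.card_le_card (hT.label_subset u))

theorem IsOver.nbar_le (hD : D.IsNNF) (hT : IsOver D H T) (x : List ℕ) :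
    T.nbar H x ≤
      (D.closure H).card * 2 ^ D.length + (D.rolesWith H).card * (D.closure H).card := by
  refine (sum_union_le_add _ _ _).trans (add_le_add ?_ (hT.sum_inherited_le x))
  refine (Finset.sum_image_le_of_nonneg fun _ _ => Nat.zero_le _).trans ?_
  exact (Finset.sum_le_card_nsmul _ _ (2 ^ D.length) fun C hC =>
    hD.atLeastNum_le_of_mem_closure (hT.label_subset x hC)).trans
      (Nat.mul_le_mul_right _ (Finset.card_le_card (hT.label_subset x)))

theorem IsOver.BAN_le (hD : D.IsNNF) (hT : IsOver D H T) (x : List ℕ) :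
    T.BAN H x ≤ D.banBound H := by
  have hweight : ∑ C ∈ T.label x, C.partWeight ≤ 3 * D.length :=
    (Finset.sum_le_sum_of_subset (hT.label_subset x)).trans (hD.sum_partWeight_closure_le H)
  refine (Nat.mul_le_mul (banClusters_le H _ (Nat.one_le_two_pow.trans (Nat.le_add_left _ _))
    ((hT.nbar_le hD x).trans (Nat.le_add_right _ (2 ^ D.length)))) (lcmOne_le _)).trans ?_
  rw [mul_assoc, ← pow_add]
  exact Nat.mul_le_mul_left _ (Nat.pow_le_pow_right two_pos (by omega))

end CTree

namespace Concept

/-- The pairs `(R, C)` for which some concept `⊠ R.C` can occur in a label. -/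
noncomputable def restrictions (D : Concept NC NR) (H : Hierarchy NR) :
    Finset (Role NR × Concept NC NR) :=
  (D.closure H).biUnion fun B => B.box.toFinset

theorem mem_restrictions {D : Concept NC NR} {H : Hierarchy NR} {p : Role NR × Concept NC NR} :
    p ∈ D.restrictions H ↔ ∃ B ∈ D.closure H, B.box = some p := by
  simp only [restrictions, Finset.mem_biUnion, Option.mem_toFinset, Option.mem_def]

theorem card_restrictions_le (D : Concept NC NR) (H : Hierarchy NR) :
    (D.restrictions H).card ≤ (D.closure H).card := by
  refine (Finset.card_biUnion_le_card_mul _ _ 1 fun B _ => ?_).trans_eq (mul_one _)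
  cases B.box <;> simp

theorem IsNNF.closure_exponent_le {D : Concept NC NR} {H : Hierarchy NR} (hD : D.IsNNF)
    (hk : 2 ≤ (D.rolesWith H).card) :
    2 * (D.closure H).card + (D.rolesWith H).card ≤ 4 * D.length * (D.rolesWith H).card := by
  have hclosure := hD.card_closure_le H
  have hlength := D.card_subs_add_numQuant_le
  have hquant := D.two_mul_numQuant_lt
  generalize (D.rolesWith H).card = k, (D.closure H).card = c, D.subs.card = s,
    D.numQuant = q, D.length = n at *
  obtain ⟨j, rfl⟩ := Nat.exists_eq_add_of_le hk
  obtain ⟨e, rfl⟩ := Nat.exists_eq_add_of_le hquant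
  nlinarith [Nat.zero_le (e * j), Nat.zero_le (q * j)]

end Concept

theorem IsSucc.asymm {x y : List ℕ} (h : IsSucc y x) : ¬ IsSucc x y := by
  rintro ⟨j, hj⟩
  obtain ⟨i, hi⟩ := h
  have hx := congrArg List.length hj
  have hy := congrArg List.length hi
  simp only [List.length_cons] at hx hy
  omega

theorem IsSucc.ne {x y : List ℕ} (h : IsSucc y x) : y ≠ x := by
  rintro rfl
  exact h.asymm h

theorem IsSucc.ne_nil {x y : List ℕ} (h : IsSucc y x) : y ≠ [] := by
  obtain ⟨i, rfl⟩ := h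
  exact List.cons_ne_nil _ _

theorem IsSucc.unique {x x' y : List ℕ} (h : IsSucc y x) (h' : IsSucc y x') : x = x' := by
  obtain ⟨i, rfl⟩ := h
  obtain ⟨j, h'⟩ := h'
  exact (List.cons.inj h').2

namespace CTree

variable {D : Concept NC NR} {H : Hierarchy NR} {T T' : CTree NC NR}

/-! ### Links to neighbours -/

theorem edgeBetween_of_isSucc {x y : List ℕ} (h : IsSucc y x) :
    T.edgeBetween x y = T.edge y :=
  if_pos h

theorem edgeBetween_of_isSucc_symm {x z : List ℕ} (h : IsSucc x z) :
    T.edgeBetween x z = (T.edge x).image Role.Inv := by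
  rw [edgeBetween, if_neg h.asymm, if_pos h]

theorem isSucc_or_isSucc_of_nonempty {x z : List ℕ} (h : (T.edgeBetween x z).Nonempty) :
    IsSucc z x ∨ IsSucc x z := by
  by_contra! hne
  simp [edgeBetween, hne.1, hne.2] at h

theorem edgeBetween_subset {x w : List ℕ} (hw : IsSucc w x → T.edge w ⊆ T'.edge w)
    (hx : T.edge x ⊆ T'.edge x) : T.edgeBetween x w ⊆ T'.edgeBetween x w := by
  unfold edgeBetween
  split_ifs with hwx
  exacts [hw hwx, Finset.image_subset_image hx, subset_rfl]

theorem RNbr.edgeBetween_nonempty {R : Role NR} {x y : List ℕ} (h : T.RNbr H R x y) :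
    (T.edgeBetween x y).Nonempty := by
  rcases h with ⟨hyx, S, hS, -⟩ | ⟨hxy, S, hS, -⟩
  · exact ⟨S, by rwa [edgeBetween_of_isSucc hyx]⟩
  · exact ⟨S.Inv, by simpa [edgeBetween_of_isSucc_symm hxy] using ⟨S, hS, rfl⟩⟩

/-- The neighbours of `x` labelled with `C` that are linked to `x` by the role `R` itself, not only
by a proper sub-role of `R`. -/
noncomputable def linked (T : CTree NC NR) (x : List ℕ) (R : Role NR) (C : Concept NC NR) :
    Finset (List ℕ) :=
  T.nodes.filter fun y => R ∈ T.edgeBetween x y ∧ C ∈ T.label y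

theorem mem_linked {x y : List ℕ} {R : Role NR} {C : Concept NC NR} :
    y ∈ T.linked x R C ↔ y ∈ T.nodes ∧ R ∈ T.edgeBetween x y ∧ C ∈ T.label y :=
  Finset.mem_filter

theorem linked_subset_nbrsWith (x : List ℕ) (R : Role NR) (C : Concept NC NR) :
    T.linked x R C ⊆ T.nbrsWith H R x C := by
  intro y hy
  obtain ⟨hy, hR, hC⟩ := mem_linked.1 hy
  refine Finset.mem_filter.2 ⟨Finset.mem_filter.2 ⟨hy, ?_⟩, hC⟩
  rcases isSucc_or_isSucc_of_nonempty ⟨R, hR⟩ with hyx | hxy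
  · exact Or.inl ⟨hyx, R, edgeBetween_of_isSucc hyx ▸ hR, Relation.ReflTransGen.refl⟩
  · rw [edgeBetween_of_isSucc_symm hxy, Finset.mem_image] at hR
    obtain ⟨S, hS, rfl⟩ := hR
    exact Or.inr ⟨hxy, S, hS, S.inv_inv.symm ▸ Relation.ReflTransGen.refl⟩

theorem linked_subset_linked {x : List ℕ} (hnodes : T.nodes ⊆ T'.nodes)
    (hedge : ∀ w ∈ T.nodes, T.edgeBetween x w ⊆ T'.edgeBetween x w)
    (hlabel : ∀ w ∈ T.nodes, T.label w ⊆ T'.label w) (R : Role NR) (C : Concept NC NR) :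
    T.linked x R C ⊆ T'.linked x R C := by
  intro w hw
  obtain ⟨hw, hR, hC⟩ := mem_linked.1 hw
  exact mem_linked.2 ⟨hnodes hw, hedge w hw hR, hlabel w hw hC⟩

/-- The sum, over the pairs `(R, C)` of the restrictions that can occur, of the numbers of
neighbours of `x` linked to `x` for `(R, C)`, each cut off at `banBound`. A node that has not been
merged away has at most that many successors. -/
noncomputable def linkSum (D : Concept NC NR) (H : Hierarchy NR) (T : CTree NC NR)
    (x : List ℕ) : ℕ :=
  ∑ p ∈ D.restrictions H, min (T.linked x p.1 p.2).card (D.banBound H)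

theorem linkSum_le (D : Concept NC NR) (H : Hierarchy NR) (T : CTree NC NR) (x : List ℕ) :
    linkSum D H T x ≤ (D.closure H).card * D.banBound H :=
  (Finset.sum_le_card_nsmul _ _ _ fun _ _ => min_le_right _ _).trans
    (Nat.mul_le_mul_right _ (D.card_restrictions_le H))

theorem linkSum_le_linkSum {x : List ℕ}
    (h : ∀ R C, (T.linked x R C).card ≤ (T'.linked x R C).card) :
    linkSum D H T x ≤ linkSum D H T' x :=
  Finset.sum_le_sum fun _ _ => min_le_min_right _ (h _ _)

theorem linkSum_lt_linkSum {x : List ℕ} {R : Role NR} {C : Concept NC NR}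
    (h : ∀ S E, (T.linked x S E).card ≤ (T'.linked x S E).card)
    (hRC : (R, C) ∈ D.restrictions H) (hlt : (T.linked x R C).card < (T'.linked x R C).card)
    (hban : (T.linked x R C).card < D.banBound H) : linkSum D H T x < linkSum D H T' x :=
  Finset.sum_lt_sum (fun _ _ => min_le_min_right _ (h _ _))
    ⟨(R, C), hRC, (min_le_left _ _).trans_lt (lt_min hlt hban)⟩

/-! ### Changes of a tree -/

/-- The conditions of the rule for `≤ n R.C` under which it merges the successor `y` of `x` into the
neighbour `z` of `x`. -/
structure Mergeable (T : CTree NC NR) (x y z : List ℕ) : Prop where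
  source_mem : y ∈ T.nodes
  target_mem : z ∈ T.nodes
  isSucc : IsSucc y x
  source_nonempty : (T.edgeBetween x y).Nonempty
  target_nonempty : (T.edgeBetween x z).Nonempty
  disjoint : Disjoint (T.edgeBetween x y) (T.edgeBetween x z)

/-- The conditions under which the generating rules create the successor `y` of `x` for a concept
`⊠ R.C`, with the condition on the number of neighbours weakened to one that is common to all
these rules. -/
structure Expandable (D : Concept NC NR) (H : Hierarchy NR) (T : CTree NC NR) (x y : List ℕ)
    (R : Role NR) (C : Concept NC NR) : Prop where
  mem : x ∈ T.nodes
  notMem : y ∉ T.nodes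
  isSucc : IsSucc y x
  not_blocked : ¬ T.Blocked x
  mem_restrictions : (R, C) ∈ D.restrictions H
  card_linked_lt : (T.linked x R C).card < D.banBound H

/-- The changes of a tree that the rules make, with those conditions of the rules on which the
bounds depend. -/
inductive Move (D : Concept NC NR) (H : Hierarchy NR) (T : CTree NC NR) : CTree NC NR → Prop
  | addConcepts {y : List ℕ} {A : Finset (Concept NC NR)} (hy : y ∈ T.nodes)
      (hA : A ⊆ D.closure H) (hnew : ¬ A ⊆ T.label y) : Move D H T (T.addConcepts y A)
  | merge {x y z : List ℕ} (h : T.Mergeable x y z) : Move D H T (T.merge x y z)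
  | addNode {x y : List ℕ} {R : Role NR} {C : Concept NC NR} (h : Expandable D H T x y R C) :
      Move D H T (T.addNode y R C)

theorem Move.addConcept {y : List ℕ} {C : Concept NC NR} (hy : y ∈ T.nodes)
    (hC : C ∈ D.closure H) (hnew : C ∉ T.label y) : Move D H T (T.addConcepts y {C}) :=
  .addConcepts hy (Finset.singleton_subset_iff.2 hC) (mt Finset.singleton_subset_iff.1 hnew)

theorem NonGen.move (hD : D.IsNNF) (hT : IsOver D H T) (h : NonGen H T T') :
    Move D H T T' := by
  have hparts {x C P} (hC : C ∈ T.label x) (hP : P ∈ C.parts) : P ∈ D.closure H :=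
    hD.parts_subset_closure (hT.label_subset x hC) hP
  cases h with
  | and_rule x C₁ C₂ hx hC _ hnew =>
    refine .addConcepts hx (fun P hP => hparts hC hP) fun hsub => hnew ?_
    simpa [Finset.insert_subset_iff] using hsub
  | or_rule x C₁ C₂ E hx hC _ hnew₁ hnew₂ hE =>
    rcases hE with rfl | rfl
    · exact .addConcept hx (hparts hC (by simp [Concept.parts])) hnew₁
    · exact .addConcept hx (hparts hC (by simp [Concept.parts])) hnew₂
  | all_rule x y R C _ hC _ hy hnew =>
    exact .addConcept (Finset.mem_filter.1 hy).1 (hparts hC (by simp [Concept.parts])) hnew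
  | all_plus_rule x y R S C _ hC _ _ hRS hy hnew =>
    exact .addConcept (Finset.mem_filter.1 hy).1
      (Concept.all_mem_closure_of_sub (hT.label_subset x hC) hRS) hnew
  | choose_rule x y R B C E _ hB hbox _ hy hnew hnew' hE =>
    have hBD := hT.label_subset x hB
    rcases hE with rfl | rfl
    · exact .addConcept (Finset.mem_filter.1 hy).1 (hD.mem_closure_of_box hBD hbox) hnew
    · exact .addConcept (Finset.mem_filter.1 hy).1 (hD.compl_mem_closure_of_box hBD hbox) hnew'
  | atMost_rule x y z n R C _ _ _ _ hy hz _ hdisj hpred =>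
    obtain ⟨hy, hyR⟩ := Finset.mem_filter.1 (Finset.mem_filter.1 hy).1
    obtain ⟨hz, hzR⟩ := Finset.mem_filter.1 (Finset.mem_filter.1 hz).1
    have hyx : IsSucc y x := (isSucc_or_isSucc_of_nonempty hyR.edgeBetween_nonempty).resolve_right
      hpred
    exact .merge ⟨hy, hz, hyx, hyR.edgeBetween_nonempty, hzR.edgeBetween_nonempty, hdisj⟩

theorem Gen.move (hD : D.IsNNF) (hT : IsOver D H T) (h : Gen H T T') : Move D H T T' := by
  have hlinked {x R C b} (hb : (T.nbrsWith H R x C).card < b) : (T.linked x R C).card < b :=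
    (Finset.card_le_card (linked_subset_nbrsWith x R C)).trans_lt hb
  have hban {x R C} (hb : (T.nbrs H R x).card < T.BAN H x) :
      (T.linked x R C).card < D.banBound H :=
    hlinked ((Finset.card_le_card (Finset.filter_subset _ _)).trans_lt
      (hb.trans_le (hT.BAN_le hD x)))
  have hrestr {x B R C} (hB : B ∈ T.label x) (hbox : B.box = some (R, C)) :
      (R, C) ∈ D.restrictions H :=
    Concept.mem_restrictions.2 ⟨B, hT.label_subset x hB, hbox⟩
  have hpow := D.two_pow_length_le_banBound H
  cases h with
  | ex_rule x y R C hx hC hb hnone hyx hy =>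
    refine .addNode ⟨hx, hy, hyx, hb, hrestr hC rfl, hlinked ?_⟩
    rw [hnone, Finset.card_empty]
    exact (Nat.two_pow_pos _).trans_le hpow
  | atLeast_rule x y n R C hx hC hb hfew hyx hy =>
    have hn : n ≤ 2 ^ D.length := hD.atLeastNum_le_of_mem_closure (hT.label_subset x hC)
    exact .addNode ⟨hx, hy, hyx, hb, hrestr hC rfl, hlinked (hfew.trans_le (hn.trans hpow))⟩
  | M_rule x y r R C hx hC hb _ hfew hyx hy =>
    exact .addNode ⟨hx, hy, hyx, hb, hrestr hC rfl, hban hfew⟩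
  | W_rule x y r R C hx hC hb _ hfew hyx hy =>
    exact .addNode ⟨hx, hy, hyx, hb, hrestr hC rfl, hban hfew⟩

/-! ### The labels after a change -/

theorem label_subset_addConcepts (y : List ℕ) (A : Finset (Concept NC NR)) (v : List ℕ) :
    T.label v ⊆ (T.addConcepts y A).label v :=
  (le_update_self_iff.2 Finset.subset_union_left : T.label ≤ (T.addConcepts y A).label) v

theorem label_subset_merge (x y z v : List ℕ) : T.label v ⊆ (T.merge x y z).label v :=
  (le_update_self_iff.2 Finset.subset_union_left : T.label ≤ (T.merge x y z).label) v

theorem edge_merge_self (x y z : List ℕ) : (T.merge x y z).edge y = ∅ :=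
  Function.update_self _ _ _

theorem edge_subset_merge {x y z v : List ℕ} (hv : v ≠ y) :
    T.edge v ⊆ (T.merge x y z).edge v := by
  simp only [CTree.merge, Function.update_of_ne hv]
  have hle (u : List ℕ) (S : Finset (Role NR)) : T.edge ≤ Function.update T.edge u (T.edge u ∪ S) :=
    le_update_self_iff.2 Finset.subset_union_left
  split_ifs
  exacts [hle _ _ v, hle _ _ v]

theorem Mergeable.edge_merge_eq_empty {x y z v : List ℕ} (h : T.Mergeable x y z)
    (hv : T.edge v = ∅) : (T.merge x y z).edge v = ∅ := by
  by_cases hvy : v = y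
  · rw [hvy, edge_merge_self]
  · have hne := h.target_nonempty
    simp only [CTree.merge, Function.update_of_ne hvy]
    split_ifs with hxz
    · rw [Function.update_of_ne ?_, hv]
      rintro rfl
      simp [edgeBetween_of_isSucc_symm hxz, hv] at hne
    · rw [Function.update_of_ne ?_, hv]
      rintro rfl
      simp [edgeBetween, hxz, hv] at hne

theorem Mergeable.ne {x y z : List ℕ} (h : T.Mergeable x y z) : y ≠ z := by
  rintro rfl
  exact h.source_nonempty.ne_empty (disjoint_self.1 h.disjoint)

theorem Mergeable.edgeBetween_source_subset {x y z : List ℕ} (h : T.Mergeable x y z) :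
    T.edgeBetween x y ⊆ (T.merge x y z).edgeBetween x z := by
  rw [edgeBetween_of_isSucc h.isSucc]
  rcases isSucc_or_isSucc_of_nonempty h.target_nonempty with hzx | hxz
  · rw [edgeBetween_of_isSucc hzx]
    simp [CTree.merge, hzx.asymm, h.ne.symm]
  · rw [edgeBetween_of_isSucc_symm hxz]
    intro R hR
    refine Finset.mem_image.2 ⟨R.Inv, ?_, R.inv_inv⟩
    simp only [CTree.merge, if_pos hxz, Function.update_of_ne h.isSucc.ne.symm,
      Function.update_self]
    exact Finset.mem_union_right _ (Finset.mem_image_of_mem _ hR)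

theorem isOver_init (D : Concept NC NR) (H : Hierarchy NR) : IsOver D H (init D) where
  label_subset x := by
    simp only [init]
    split_ifs
    exacts [Finset.singleton_subset_iff.2 (D.self_mem_closure H), Finset.empty_subset _]
  edge_subset _ := Finset.empty_subset _

theorem IsOver.addConcepts (hT : IsOver D H T) {y : List ℕ} {A : Finset (Concept NC NR)}
    (hA : A ⊆ D.closure H) : IsOver D H (T.addConcepts y A) where
  label_subset := (Function.forall_update_iff _ fun _ L => L ⊆ D.closure H).2
    ⟨Finset.union_subset (hT.label_subset y) hA, fun x _ => hT.label_subset x⟩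
  edge_subset := hT.edge_subset

theorem IsOver.merge (hT : IsOver D H T) (x y z : List ℕ) : IsOver D H (T.merge x y z) where
  label_subset := (Function.forall_update_iff _ fun _ L => L ⊆ D.closure H).2
    ⟨Finset.union_subset (hT.label_subset z) (hT.label_subset y), fun v _ => hT.label_subset v⟩
  edge_subset := by
    have hinv : (T.edge y).image Role.Inv ⊆ D.rolesWith H :=
      Finset.image_subset_iff.2 fun _ hS => Concept.inv_mem_rolesWith (hT.edge_subset y hS)
    refine (Function.forall_update_iff _ fun _ S => S ⊆ D.rolesWith H).2
      ⟨Finset.empty_subset _, fun v _ => ?_⟩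
    split_ifs
    · exact (Function.forall_update_iff _ fun _ S => S ⊆ D.rolesWith H).2
        ⟨Finset.union_subset (hT.edge_subset x) hinv, fun v _ => hT.edge_subset v⟩ v
    · exact (Function.forall_update_iff _ fun _ S => S ⊆ D.rolesWith H).2
        ⟨Finset.union_subset (hT.edge_subset z) (hT.edge_subset y), fun v _ => hT.edge_subset v⟩ v

theorem IsOver.addNode (hT : IsOver D H T) {y : List ℕ} {R : Role NR} {C : Concept NC NR}
    (hR : R ∈ D.rolesWith H) (hC : C ∈ D.closure H) : IsOver D H (T.addNode y R C) where
  label_subset := (Function.forall_update_iff _ fun _ L => L ⊆ D.closure H).2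
    ⟨Finset.singleton_subset_iff.2 hC, fun x _ => hT.label_subset x⟩
  edge_subset := (Function.forall_update_iff _ fun _ S => S ⊆ D.rolesWith H).2
    ⟨Finset.singleton_subset_iff.2 hR, fun x _ => hT.edge_subset x⟩

/-! ### The links after a change -/

theorem linked_subset_addConcepts (x y : List ℕ) (A : Finset (Concept NC NR)) (R : Role NR)
    (C : Concept NC NR) : T.linked x R C ⊆ (T.addConcepts y A).linked x R C :=
  linked_subset_linked (T := T) (T' := T.addConcepts y A) subset_rfl (fun _ _ => subset_rfl)
    (fun w _ => label_subset_addConcepts y A w) R C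

theorem Mergeable.linked_subset {x y z v : List ℕ} (h : T.Mergeable x y z) (hvx : v ≠ x)
    (hvy : v ≠ y) (R : Role NR) (C : Concept NC NR) :
    T.linked v R C ⊆ (T.merge x y z).linked v R C := by
  refine linked_subset_linked (T := T) (T' := T.merge x y z) subset_rfl
    (fun w _ => edgeBetween_subset (fun hwv => ?_) (edge_subset_merge hvy))
    (fun w _ => label_subset_merge x y z w) R C
  refine edge_subset_merge ?_
  rintro rfl
  exact hvx (hwv.unique h.isSucc)

/-- Since the roles on the edges to `y` and `z` are disjoint, no link is lost when `z` takes over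
the links of `y`. -/
theorem Mergeable.card_linked_self_le {x y z : List ℕ} (h : T.Mergeable x y z) (R : Role NR)
    (C : Concept NC NR) : (T.linked x R C).card ≤ ((T.merge x y z).linked x R C).card := by
  have hz : y ∈ T.linked x R C → z ∉ T.linked x R C := fun hy hz =>
    Finset.disjoint_left.1 h.disjoint (mem_linked.1 hy).2.1 (mem_linked.1 hz).2.1
  refine Finset.card_le_card_of_injOn (fun w => if w = y then z else w) (fun w hw => ?_)
    fun w hw w' hw' heq => ?_
  · obtain ⟨hwT, hR, hC⟩ := mem_linked.1 hw
    by_cases hwy : w = y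
    · subst hwy
      simp only [if_true]
      refine mem_linked.2 ⟨h.target_mem, h.edgeBetween_source_subset hR, ?_⟩
      simp [CTree.merge, hC]
    · simp only [if_neg hwy]
      exact mem_linked.2 ⟨hwT, edgeBetween_subset (fun _ => edge_subset_merge hwy)
        (edge_subset_merge h.isSucc.ne.symm) hR, label_subset_merge x y z w hC⟩
  · simp only at heq
    split_ifs at heq with hwy hwy' hwy'
    · rw [hwy, hwy']
    · exact absurd (heq ▸ hw') (hz (hwy ▸ hw))
    · exact absurd (heq ▸ hw) (hz (hwy' ▸ hw'))
    · exact heq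

theorem Mergeable.card_linked_le {x y z v : List ℕ} (h : T.Mergeable x y z) (hvy : v ≠ y)
    (R : Role NR) (C : Concept NC NR) :
    (T.linked v R C).card ≤ ((T.merge x y z).linked v R C).card := by
  by_cases hvx : v = x
  · subst hvx
    exact h.card_linked_self_le R C
  · exact Finset.card_le_card (h.linked_subset hvx hvy R C)

theorem linked_subset_addNode {x y : List ℕ} (hx : x ∈ T.nodes) (hy : y ∉ T.nodes) (R : Role NR)
    (C : Concept NC NR) (S : Role NR) (E : Concept NC NR) :
    T.linked x S E ⊆ (T.addNode y R C).linked x S E := by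
  have hedge : ∀ w ∈ T.nodes, T.edge w ⊆ (T.addNode y R C).edge w := fun w hw => by
    simp [addNode, ne_of_mem_of_not_mem hw hy]
  refine linked_subset_linked (Finset.subset_insert _ _)
    (fun w hw => edgeBetween_subset (fun _ => hedge w hw) (hedge x hx)) (fun w hw => ?_) S E
  simp [addNode, ne_of_mem_of_not_mem hw hy]

theorem card_linked_lt_addNode {x y : List ℕ} (hx : x ∈ T.nodes) (hy : y ∉ T.nodes)
    (hyx : IsSucc y x) (R : Role NR) (C : Concept NC NR) :
    (T.linked x R C).card < ((T.addNode y R C).linked x R C).card := by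
  refine Finset.card_lt_card ((Finset.ssubset_iff_of_subset
    (linked_subset_addNode hx hy R C R C)).2 ⟨y, mem_linked.2 ⟨?_, ?_, ?_⟩, fun h =>
      hy (mem_linked.1 h).1⟩)
  · exact Finset.mem_insert_self _ _
  · simp [edgeBetween_of_isSucc hyx, addNode]
  · simp [addNode]

theorem Expandable.linkSum_lt {x y : List ℕ} {R : Role NR} {C : Concept NC NR}
    (h : Expandable D H T x y R C) : linkSum D H T x < linkSum D H (T.addNode y R C) x :=
  linkSum_lt_linkSum
    (fun S E => Finset.card_le_card (linked_subset_addNode h.mem h.notMem R C S E))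
    h.mem_restrictions (card_linked_lt_addNode h.mem h.notMem h.isSucc R C) h.card_linked_lt

theorem outDegree_addNode_of_not_isSucc {x y : List ℕ} (R : Role NR) (C : Concept NC NR)
    (h : ¬ IsSucc y x) : (T.addNode y R C).outDegree x = T.outDegree x := by
  simp [outDegree, addNode, Finset.filter_insert, h]

theorem outDegree_addNode_le (x y : List ℕ) (R : Role NR) (C : Concept NC NR) :
    (T.addNode y R C).outDegree x ≤ T.outDegree x + 1 := by
  simp only [outDegree, addNode, Finset.filter_insert]
  split_ifs
  exacts [Finset.card_insert_le _ _, Nat.le_succ _]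

/-! ### Blocking and the length of paths -/

/-- The triples of labels at `x` and its ancestors, except the root, that pairwise blocking
compares. -/
noncomputable def triples (T : CTree NC NR) : List ℕ →
    Finset (Finset (Concept NC NR) × Finset (Concept NC NR) × Finset (Role NR))
  | [] => ∅
  | i :: x => insert (T.label (i :: x), T.label x, T.edge (i :: x)) (T.triples x)

theorem exists_of_mem_triples {x : List ℕ}
    {p : Finset (Concept NC NR) × Finset (Concept NC NR) × Finset (Role NR)}
    (h : p ∈ T.triples x) :
    ∃ (j : ℕ) (y : List ℕ), (j :: y) <:+ x ∧
      p = (T.label (j :: y), T.label y, T.edge (j :: y)) := by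
  induction x with
  | nil => simp [triples] at h
  | cons i x ih =>
    rcases Finset.mem_insert.1 h with rfl | h
    · exact ⟨i, x, List.suffix_rfl, rfl⟩
    · obtain ⟨j, y, hy, hp⟩ := ih h
      exact ⟨j, y, hy.trans (List.suffix_cons i x), hp⟩

theorem card_triples_of_not_blocked {x : List ℕ} (h : ¬ T.Blocked x) :
    (T.triples x).card = x.length := by
  induction x with
  | nil => rfl
  | cons i x ih =>
    rw [triples, Finset.card_insert_of_notMem, ih fun hx => h (Or.inl hx), List.length_cons]
    intro hmem
    obtain ⟨j, y, hy, hp⟩ := exists_of_mem_triples hmem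
    simp only [Prod.mk.injEq] at hp
    exact h (Or.inr (Or.inr ⟨j, y, hy, hp⟩))

theorem IsOver.triples_subset (hT : IsOver D H T) {x : List ℕ} (h : ¬ T.Blocked x) :
    T.triples x ⊆ (D.closure H).powerset ×ˢ (D.closure H).powerset ×ˢ
      (D.rolesWith H).powerset.erase ∅ := by
  induction x with
  | nil => exact Finset.empty_subset _
  | cons i x ih =>
    refine Finset.insert_subset ?_ (ih fun hx => h (Or.inl hx))
    simp only [Finset.mem_product, Finset.mem_powerset, Finset.mem_erase]
    exact ⟨hT.label_subset _, hT.label_subset _, fun he => h (Or.inr (Or.inl he)),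
      hT.edge_subset _⟩

theorem IsOver.length_lt_of_not_blocked (hT : IsOver D H T) {x : List ℕ} (h : ¬ T.Blocked x) :
    x.length < 2 ^ (2 * (D.closure H).card + (D.rolesWith H).card) := by
  have hcard := Finset.card_le_card (hT.triples_subset h)
  rw [card_triples_of_not_blocked h, Finset.card_product, Finset.card_product,
    Finset.card_erase_of_mem (Finset.empty_mem_powerset _), Finset.card_powerset,
    Finset.card_powerset, ← mul_assoc, ← pow_add, ← two_mul] at hcard
  refine hcard.trans_lt ?_
  rw [pow_add]
  exact Nat.mul_lt_mul_of_pos_left (Nat.sub_lt (Nat.two_pow_pos _) one_pos) (Nat.two_pow_pos _)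

/-! ### The invariant of the algorithm -/

/-- `x` is the root or has not been merged into another node. -/
def Live (T : CTree NC NR) (x : List ℕ) : Prop := x = [] ∨ T.edge x ≠ ∅

theorem live_of_not_blocked {x : List ℕ} (h : ¬ T.Blocked x) : T.Live x := by
  cases x with
  | nil => exact Or.inl rfl
  | cons i x => exact Or.inr fun he => h (Or.inr (Or.inl he))

theorem Mergeable.live_of_live_merge {x y z v : List ℕ} (h : T.Mergeable x y z)
    (hv : (T.merge x y z).Live v) : T.Live v :=
  hv.imp_right (mt h.edge_merge_eq_empty)

theorem Mergeable.ne_of_live_merge {x y z v : List ℕ} (h : T.Mergeable x y z)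
    (hv : (T.merge x y z).Live v) : v ≠ y := by
  rintro rfl
  exact hv.elim h.isSucc.ne_nil fun he => he (edge_merge_self x v z)

theorem live_addNode_iff {x y : List ℕ} (hxy : x ≠ y) (R : Role NR) (C : Concept NC NR) :
    (T.addNode y R C).Live x ↔ T.Live x := by
  simp [Live, addNode, hxy]

/-- The properties of the trees generated for `D` from which the bounds follow. The bound by
`linkSum` makes the uniform bound of the out-degree inductive: it holds when a node is added, and a
node merged away, for which it may be lost, gets no further successors. -/
structure Bounded (D : Concept NC NR) (H : Hierarchy NR) (T : CTree NC NR) : Prop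
    extends IsOver D H T where
  tail : ∀ i x, i :: x ∈ T.nodes → x ∈ T.nodes
  length_le : ∀ x ∈ T.nodes, x.length ≤ 2 ^ (4 * D.length * (D.rolesWith H).card)
  outDegree_le : ∀ x ∈ T.nodes, T.outDegree x ≤ (D.closure H).card * D.banBound H
  outDegree_le_linkSum : ∀ x ∈ T.nodes, T.Live x → T.outDegree x ≤ linkSum D H T x

theorem outDegree_init (D : Concept NC NR) (x : List ℕ) : (init D).outDegree x = 0 := by
  refine Finset.card_eq_zero.2 (Finset.filter_eq_empty_iff.2 fun y hy hyx => hyx.ne_nil ?_)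
  exact Finset.mem_singleton.1 hy

theorem bounded_init (D : Concept NC NR) (H : Hierarchy NR) : Bounded D H (init D) where
  toIsOver := isOver_init D H
  tail i x h := absurd (Finset.mem_singleton.1 h) (List.cons_ne_nil i x)
  length_le x hx := by
    rw [Finset.mem_singleton.1 hx]
    exact Nat.zero_le _
  outDegree_le x _ := (outDegree_init D x).trans_le (Nat.zero_le _)
  outDegree_le_linkSum x _ _ := (outDegree_init D x).trans_le (Nat.zero_le _)

theorem Bounded.addConcepts (h : Bounded D H T) {y : List ℕ} {A : Finset (Concept NC NR)}
    (hA : A ⊆ D.closure H) : Bounded D H (T.addConcepts y A) where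
  toIsOver := h.toIsOver.addConcepts hA
  tail := h.tail
  length_le := h.length_le
  outDegree_le := h.outDegree_le
  outDegree_le_linkSum x hx hlive := (h.outDegree_le_linkSum x hx hlive).trans
    (linkSum_le_linkSum fun R C => Finset.card_le_card (linked_subset_addConcepts x y A R C))

theorem Bounded.merge (h : Bounded D H T) {x y z : List ℕ} (hm : T.Mergeable x y z) :
    Bounded D H (T.merge x y z) where
  toIsOver := h.toIsOver.merge x y z
  tail := h.tail
  length_le := h.length_le
  outDegree_le := h.outDegree_le
  outDegree_le_linkSum v hv hlive :=
    (h.outDegree_le_linkSum v hv (hm.live_of_live_merge hlive)).trans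
      (linkSum_le_linkSum (hm.card_linked_le (hm.ne_of_live_merge hlive)))

theorem Bounded.outDegree_addNode_self (h : Bounded D H T) {y : List ℕ} (hy : y ∉ T.nodes)
    (R : Role NR) (C : Concept NC NR) : (T.addNode y R C).outDegree y = 0 := by
  rw [outDegree_addNode_of_not_isSucc R C fun hyy => hyy.ne rfl]
  refine Finset.card_eq_zero.2 (Finset.filter_eq_empty_iff.2 fun w hw hwy => hy ?_)
  obtain ⟨i, rfl⟩ := hwy
  exact h.tail i y hw

theorem Bounded.outDegree_addNode_le_linkSum (h : Bounded D H T) {x y v : List ℕ} {R : Role NR}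
    {C : Concept NC NR} (hm : Expandable D H T x y R C) (hv : v ∈ T.nodes) (hlive : T.Live v) :
    (T.addNode y R C).outDegree v ≤ linkSum D H (T.addNode y R C) v := by
  by_cases hvx : v = x
  · subst hvx
    exact (outDegree_addNode_le v y R C).trans
      ((h.outDegree_le_linkSum v hv hlive).trans_lt hm.linkSum_lt)
  · rw [outDegree_addNode_of_not_isSucc R C fun hyv => hvx (hyv.unique hm.isSucc)]
    exact (h.outDegree_le_linkSum v hv hlive).trans (linkSum_le_linkSum fun S E =>
      Finset.card_le_card (linked_subset_addNode hv hm.notMem R C S E))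

theorem Bounded.outDegree_addNode_le (h : Bounded D H T) {x y v : List ℕ} {R : Role NR}
    {C : Concept NC NR} (hm : Expandable D H T x y R C) (hv : v ∈ T.nodes) :
    (T.addNode y R C).outDegree v ≤ (D.closure H).card * D.banBound H := by
  by_cases hvx : v = x
  · subst hvx
    exact (h.outDegree_addNode_le_linkSum hm hv (live_of_not_blocked hm.not_blocked)).trans
      (linkSum_le D H _ v)
  · rw [outDegree_addNode_of_not_isSucc R C fun hyv => hvx (hyv.unique hm.isSucc)]
    exact h.outDegree_le v hv

theorem Expandable.length_le (hD : D.IsNNF) (hT : IsOver D H T) {x y : List ℕ} {R : Role NR}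
    {C : Concept NC NR} (hm : Expandable D H T x y R C) :
    y.length ≤ 2 ^ (4 * D.length * (D.rolesWith H).card) := by
  obtain ⟨B, hB, hbox⟩ := Concept.mem_restrictions.1 hm.mem_restrictions
  have hk := Concept.two_le_card_rolesWith (hD.mem_rolesWith_of_box hB hbox)
  obtain ⟨i, rfl⟩ := hm.isSucc
  exact (hT.length_lt_of_not_blocked hm.not_blocked).trans_le
    (Nat.pow_le_pow_right two_pos (hD.closure_exponent_le hk))

theorem Bounded.addNode (hD : D.IsNNF) (h : Bounded D H T) {x y : List ℕ} {R : Role NR}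
    {C : Concept NC NR} (hm : Expandable D H T x y R C) : Bounded D H (T.addNode y R C) where
  toIsOver := by
    obtain ⟨B, hB, hbox⟩ := Concept.mem_restrictions.1 hm.mem_restrictions
    exact h.toIsOver.addNode (hD.mem_rolesWith_of_box hB hbox) (hD.mem_closure_of_box hB hbox)
  tail i v hv := by
    refine Finset.mem_insert_of_mem ?_
    rcases Finset.mem_insert.1 hv with hvy | hv
    · exact IsSucc.unique ⟨i, hvy.symm⟩ hm.isSucc ▸ hm.mem
    · exact h.tail i v hv
  length_le v hv := by
    rcases Finset.mem_insert.1 hv with rfl | hv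
    · exact hm.length_le hD h.toIsOver
    · exact h.length_le v hv
  outDegree_le v hv := by
    rcases Finset.mem_insert.1 hv with rfl | hv
    · exact (h.outDegree_addNode_self hm.notMem R C).trans_le (Nat.zero_le _)
    · exact h.outDegree_addNode_le hm hv
  outDegree_le_linkSum v hv hlive := by
    rcases Finset.mem_insert.1 hv with rfl | hv
    · exact (h.outDegree_addNode_self hm.notMem R C).trans_le (Nat.zero_le _)
    · exact h.outDegree_addNode_le_linkSum hm hv
        ((live_addNode_iff (ne_of_mem_of_not_mem hv hm.notMem) R C).1 hlive)

theorem Move.bounded (hD : D.IsNNF) (h : Bounded D H T) (hm : Move D H T T') :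
    Bounded D H T' := by
  cases hm with
  | addConcepts _ hA _ => exact h.addConcepts hA
  | merge hm => exact h.merge hm
  | addNode hm => exact h.addNode hD hm

/-- A rule application, without the priority of the non-generating rules. -/
def RuleStep (H : Hierarchy NR) (T T' : CTree NC NR) : Prop := NonGen H T T' ∨ Gen H T T'

/-- `t 0, …, t m` arises from the initial tree for `D` by `m` rule applications, in any order. -/
def IsRuleSeq (H : Hierarchy NR) (D : Concept NC NR) (m : ℕ) (t : ℕ → CTree NC NR) : Prop :=
  t 0 = init D ∧ ∀ i < m, RuleStep H (t i) (t (i + 1))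

theorem IsRun.isRuleSeq {m : ℕ} {t : ℕ → CTree NC NR} (h : IsRun H D m t) : IsRuleSeq H D m t :=
  ⟨h.1, fun i hi => (h.2 i hi).imp_right And.right⟩

theorem RuleStep.move (hD : D.IsNNF) (hT : IsOver D H T) (h : RuleStep H T T') :
    Move D H T T' :=
  h.elim (NonGen.move hD hT) (Gen.move hD hT)

theorem IsRuleSeq.bounded (hD : D.IsNNF) {m : ℕ} {t : ℕ → CTree NC NR}
    (h : IsRuleSeq H D m t) {i : ℕ} (hi : i ≤ m) : Bounded D H (t i) := by
  induction i with
  | zero => exact h.1 ▸ bounded_init D H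
  | succ i ih =>
    have hb := ih (Nat.le_of_succ_le hi)
    exact ((h.2 i hi).move hD hb.toIsOver).bounded hD hb

/-! ### Termination -/

section Value

variable {k : ℕ}

/-- The contribution of an edge label of at most `k` roles to the measure `value`. The empty label
of a node that has been merged away counts most, so that merging increases the measure. -/
noncomputable def edgeValue (k : ℕ) (S : Finset (Role NR)) : ℕ := if S = ∅ then k + 1 else S.card

theorem edgeValue_le {S : Finset (Role NR)} (h : S.card ≤ k) : edgeValue k S ≤ k + 1 := by
  unfold edgeValue
  split_ifs <;> omega

theorem edgeValue_mono {S S' : Finset (Role NR)} (hS : S ⊆ S') (hempty : S = ∅ → S' = ∅) :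
    edgeValue k S ≤ edgeValue k S' := by
  rcases S.eq_empty_or_nonempty with rfl | hne
  · rw [hempty rfl]
  · rw [edgeValue, edgeValue, if_neg hne.ne_empty, if_neg (hne.mono hS).ne_empty]
    exact Finset.card_le_card hS

theorem edgeValue_lt_edgeValue_empty {S : Finset (Role NR)} (hS : S.Nonempty) (h : S.card ≤ k) :
    edgeValue k S < edgeValue k (∅ : Finset (Role NR)) := by
  rw [edgeValue, edgeValue, if_neg hS.ne_empty, if_pos rfl]
  exact Nat.lt_succ_of_le h

/-- The contribution of the node `x` to the measure `value`. -/
noncomputable def nodeValue (k : ℕ) (T : CTree NC NR) (x : List ℕ) : ℕ :=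
  1 + (T.label x).card + edgeValue k (T.edge x)

/-- A measure that increases with every rule application if no edge label has more than `k`
roles. -/
noncomputable def value (k : ℕ) (T : CTree NC NR) : ℕ := ∑ x ∈ T.nodes, T.nodeValue k x

theorem value_lt_addConcepts {y : List ℕ} {A : Finset (Concept NC NR)} (hy : y ∈ T.nodes)
    (hA : ¬ A ⊆ T.label y) : T.value k < (T.addConcepts y A).value k := by
  have hlabel := label_subset_addConcepts (T := T) y A
  have hnew : T.label y ⊂ (T.addConcepts y A).label y := by
    refine ⟨hlabel y, fun hsub => hA (Finset.Subset.trans ?_ hsub)⟩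
    simp [addConcepts]
  exact Finset.sum_lt_sum
    (fun v _ => Nat.add_le_add_right (Nat.add_le_add_left (Finset.card_le_card (hlabel v)) 1) _)
    ⟨y, hy, Nat.add_lt_add_right (Nat.add_lt_add_left (Finset.card_lt_card hnew) 1) _⟩

theorem Mergeable.value_lt {x y z : List ℕ} (h : T.Mergeable x y z)
    (hk : ∀ v, (T.edge v).card ≤ k) : T.value k < (T.merge x y z).value k := by
  have hlabel (v) : 1 + (T.label v).card ≤ 1 + ((T.merge x y z).label v).card :=
    Nat.add_le_add_left (Finset.card_le_card (label_subset_merge x y z v)) 1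
  have hy : T.nodeValue k y < (T.merge x y z).nodeValue k y := by
    refine Nat.add_lt_add_of_le_of_lt (hlabel y) ?_
    rw [edge_merge_self]
    exact edgeValue_lt_edgeValue_empty (edgeBetween_of_isSucc h.isSucc ▸ h.source_nonempty) (hk y)
  refine Finset.sum_lt_sum (fun v _ => ?_) ⟨y, h.source_mem, hy⟩
  by_cases hvy : v = y
  · exact hvy ▸ hy.le
  · exact Nat.add_le_add (hlabel v)
      (edgeValue_mono (edge_subset_merge hvy) h.edge_merge_eq_empty)

theorem value_lt_addNode {y : List ℕ} (hy : y ∉ T.nodes) (R : Role NR) (C : Concept NC NR) :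
    T.value k < (T.addNode y R C).value k := by
  have hold : ∀ v ∈ T.nodes, T.nodeValue k v = (T.addNode y R C).nodeValue k v := fun v hv => by
    simp [nodeValue, addNode, ne_of_mem_of_not_mem hv hy]
  have hnew : 0 < (T.addNode y R C).nodeValue k y := by
    unfold nodeValue
    omega
  calc T.value k = ∑ v ∈ T.nodes, (T.addNode y R C).nodeValue k v := Finset.sum_congr rfl hold
    _ < (T.addNode y R C).nodeValue k y + ∑ v ∈ T.nodes, (T.addNode y R C).nodeValue k v :=
      Nat.lt_add_of_pos_left hnew
    _ = (T.addNode y R C).value k := (Finset.sum_insert hy).symm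

theorem Move.value_lt (hk : ∀ x, (T.edge x).card ≤ k) (hm : Move D H T T') :
    T.value k < T'.value k := by
  cases hm with
  | addConcepts hy _ hnew => exact value_lt_addConcepts hy hnew
  | merge hm => exact hm.value_lt hk
  | addNode hm => exact value_lt_addNode hm.notMem _ _

end Value

theorem nodes_filter_length_succ_subset (htail : ∀ i x, i :: x ∈ T.nodes → x ∈ T.nodes) (l : ℕ) :
    (T.nodes.filter fun x => x.length ≤ l + 1) ⊆
      (T.nodes.filter fun x => x.length ≤ l) ∪ (T.nodes.filter fun x => x.length ≤ l).biUnion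
        fun x => T.nodes.filter fun y => IsSucc y x := by
  intro x hx
  obtain ⟨hx, hl⟩ := Finset.mem_filter.1 hx
  cases x with
  | nil => exact Finset.mem_union_left _ (Finset.mem_filter.2 ⟨hx, Nat.zero_le _⟩)
  | cons i x =>
    exact Finset.mem_union_right _ (Finset.mem_biUnion.2 ⟨x, Finset.mem_filter.2
      ⟨htail i x hx, Nat.le_of_succ_le_succ hl⟩, Finset.mem_filter.2 ⟨hx, i, rfl⟩⟩)

theorem card_nodes_filter_length_le {b : ℕ} (htail : ∀ i x, i :: x ∈ T.nodes → x ∈ T.nodes)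
    (hdeg : ∀ x ∈ T.nodes, T.outDegree x ≤ b) (l : ℕ) :
    (T.nodes.filter fun x => x.length ≤ l).card ≤ (b + 1) ^ l := by
  induction l with
  | zero =>
    rw [pow_zero, Finset.card_le_one]
    intro x hx y hy
    simp only [Finset.mem_filter, nonpos_iff_eq_zero, List.length_eq_zero_iff] at hx hy
    rw [hx.2, hy.2]
  | succ l ih =>
    set s := T.nodes.filter fun x => x.length ≤ l
    have hsucc : (s.biUnion fun x => T.nodes.filter fun y => IsSucc y x).card ≤ s.card * b :=
      Finset.card_biUnion_le_card_mul _ _ b fun x hx => hdeg x (Finset.mem_filter.1 hx).1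
    calc _ ≤ s.card + (s.biUnion fun x => T.nodes.filter fun y => IsSucc y x).card :=
          (Finset.card_le_card (nodes_filter_length_succ_subset htail l)).trans
            (Finset.card_union_le _ _)
      _ ≤ s.card + s.card * b := Nat.add_le_add_left hsucc _
      _ = s.card * (b + 1) := by ring
      _ ≤ (b + 1) ^ l * (b + 1) := Nat.mul_le_mul_right _ ih
      _ = (b + 1) ^ (l + 1) := (pow_succ _ _).symm

theorem Bounded.card_nodes_le (h : Bounded D H T) :
    T.nodes.card ≤ ((D.closure H).card * D.banBound H + 1) ^
      2 ^ (4 * D.length * (D.rolesWith H).card) := by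
  have hcard := card_nodes_filter_length_le h.tail h.outDegree_le
    (2 ^ (4 * D.length * (D.rolesWith H).card))
  rwa [Finset.filter_eq_self.2 h.length_le] at hcard

theorem IsOver.nodeValue_le (hT : IsOver D H T) (x : List ℕ) :
    T.nodeValue (D.rolesWith H).card x ≤
      1 + (D.closure H).card + ((D.rolesWith H).card + 1) :=
  Nat.add_le_add (Nat.add_le_add_left (Finset.card_le_card (hT.label_subset x)) 1)
    (edgeValue_le (Finset.card_le_card (hT.edge_subset x)))

/-- A bound of the number of rule applications for `D`: a bound of the number of nodes times a bound
of the contribution of a node to the measure `value`. -/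
noncomputable def runBound (D : Concept NC NR) (H : Hierarchy NR) : ℕ :=
  ((D.closure H).card * D.banBound H + 1) ^ 2 ^ (4 * D.length * (D.rolesWith H).card) *
    (1 + (D.closure H).card + ((D.rolesWith H).card + 1))

theorem Bounded.value_le (h : Bounded D H T) :
    T.value (D.rolesWith H).card ≤ runBound D H :=
  (Finset.sum_le_card_nsmul _ _ _ fun x _ => h.toIsOver.nodeValue_le x).trans
    (Nat.mul_le_mul_right _ h.card_nodes_le)

theorem IsRuleSeq.le_value (hD : D.IsNNF) {m : ℕ} {t : ℕ → CTree NC NR}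
    (h : IsRuleSeq H D m t) {i : ℕ} (hi : i ≤ m) : i ≤ (t i).value (D.rolesWith H).card := by
  induction i with
  | zero => exact Nat.zero_le _
  | succ i ih =>
    have hT := (h.bounded hD (Nat.le_of_succ_le hi)).toIsOver
    exact (ih (Nat.le_of_succ_le hi)).trans_lt
      (((h.2 i hi).move hD hT).value_lt fun x => Finset.card_le_card (hT.edge_subset x))

theorem IsRuleSeq.le_runBound (hD : D.IsNNF) {m : ℕ} {t : ℕ → CTree NC NR}
    (h : IsRuleSeq H D m t) : m ≤ runBound D H :=
  (h.le_value hD le_rfl).trans (h.bounded hD le_rfl).value_le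

end CTree

/-! ### The numerical bound of the out-degree -/

namespace Concept

variable {D : Concept NC NR} {H : Hierarchy NR}

theorem IsNNF.card_closure_le_two_pow (hD : D.IsNNF) {m : ℕ} (hlength : D.length ≤ m)
    (hroles : (D.rolesWith H).card ≤ 2 * m + 1) : (D.closure H).card ≤ 2 ^ (2 * m + 4) := by
  have hclosure := hD.card_closure_le H
  have hsubs := D.card_subs_add_numQuant_le
  have hm : m < 2 ^ m := Nat.lt_two_pow_self
  have hquant : (D.rolesWith H).card * (2 * D.numQuant) ≤ (2 * m + 1) * (2 * m) :=
    Nat.mul_le_mul hroles (by omega)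
  have hsq : m * m ≤ 2 ^ m * 2 ^ m := Nat.mul_le_mul hm.le hm.le
  have hpow : 2 ^ (2 * m + 4) = 16 * (2 ^ m * 2 ^ m) := by ring
  nlinarith [Nat.le_mul_self m]

theorem IsNNF.banBound_le_two_pow (hD : D.IsNNF) {m : ℕ} (hlength : D.length ≤ m)
    (hroles : (D.rolesWith H).card ≤ 2 * m + 1) : D.banBound H ≤ 2 ^ (12 * m + 7) := by
  have hclosure := hD.card_closure_le_two_pow hlength hroles
  have hroles_pow : (D.rolesWith H).card ≤ 2 ^ (m + 1) := by
    have hm : m < 2 ^ m := Nat.lt_two_pow_self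
    rw [pow_succ]
    omega
  have hlength_pow : 2 ^ D.length ≤ 2 ^ (m + 1) := Nat.pow_le_pow_right two_pos (by omega)
  have hprod : 2 ^ (3 * m + 5) = 2 ^ (2 * m + 4) * 2 ^ (m + 1) := by ring
  have hsum : (D.closure H).card * 2 ^ D.length + (D.rolesWith H).card * (D.closure H).card +
      2 ^ D.length ≤ 2 ^ (3 * m + 7) := by
    have hnum := Nat.mul_le_mul hclosure hlength_pow
    have hinherited := Nat.mul_le_mul hroles_pow hclosure
    have hone : 2 ^ (m + 1) ≤ 2 ^ (3 * m + 5) := Nat.pow_le_pow_right two_pos (by omega)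
    rw [mul_comm (2 ^ (m + 1))] at hinherited
    have hfour : 2 ^ (3 * m + 7) = 4 * 2 ^ (3 * m + 5) := by ring
    omega
  calc D.banBound H ≤ 2 ^ (3 * m + 7) * 2 ^ (9 * m) :=
        Nat.mul_le_mul hsum (Nat.pow_le_pow_right two_pos (by omega))
    _ = 2 ^ (12 * m + 7) := by ring

theorem IsNNF.card_closure_mul_banBound_le (hD : D.IsNNF) (H : Hierarchy NR) :
    (D.closure H).card * D.banBound H ≤
      2 ^ 60 * 2 ^ (max D.length ((D.rolesWith H).card / 2)) ^ 2 := by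
  set m := max D.length ((D.rolesWith H).card / 2)
  have hlength : D.length ≤ m := le_max_left _ _
  have hroles : (D.rolesWith H).card ≤ 2 * m + 1 := by
    have hhalf : (D.rolesWith H).card / 2 ≤ m := le_max_right _ _
    omega
  calc (D.closure H).card * D.banBound H ≤ 2 ^ (2 * m + 4) * 2 ^ (12 * m + 7) :=
        Nat.mul_le_mul (hD.card_closure_le_two_pow hlength hroles)
          (hD.banBound_le_two_pow hlength hroles)
    _ = 2 ^ (14 * m + 11) := by ring
    _ ≤ 2 ^ (60 + m ^ 2) := by
        refine Nat.pow_le_pow_right two_pos ?_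
        zify
        nlinarith [sq_nonneg ((m : ℤ) - 7)]
    _ = 2 ^ 60 * 2 ^ m ^ 2 := pow_add _ _ _

end Concept

end ALCQPIH

theorem mainTheorem4_general {NC : Type u} {NR : Type v} (H : ALCQPIH.Hierarchy NR)
    {D : ALCQPIH.Concept NC NR} (hD : D.IsNNF) :
    (∃ N : ℕ, ∀ (m : ℕ) (t : ℕ → ALCQPIH.CTree NC NR),
      ALCQPIH.CTree.IsRuleSeq H D m t → m ≤ N) ∧
    (∀ (m : ℕ) (t : ℕ → ALCQPIH.CTree NC NR), ALCQPIH.CTree.IsRuleSeq H D m t →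
      ∀ x ∈ (t m).nodes,
        x.length ≤ 2 ^ (4 * D.length * (D.rolesWith H).card) ∧
        (t m).outDegree x ≤ 2 ^ 60 * 2 ^ (max D.length ((D.rolesWith H).card / 2)) ^ 2) := by
  refine ⟨⟨ALCQPIH.CTree.runBound D H, fun m t h => h.le_runBound hD⟩, fun m t h x hx => ?_⟩
  have hbounded := h.bounded hD le_rfl
  exact ⟨hbounded.length_le x hx,
    (hbounded.outDegree_le x hx).trans (hD.card_closure_mul_banBound_le H)⟩

theorem mainTheorem4 :
    ∃ c : ℕ, ∀ (NC : Type u) (NR : Type v) (Q₀ : Set ℚ), (∀ r ∈ Q₀, 0 < r ∧ r < 1) →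
      ∀ (H : ALCQPIH.Hierarchy NR) (D : ALCQPIH.Concept NC NR), D.IsConcept Q₀ H →
        -- the length of all sequences of rule applications is bounded
        (∃ N : ℕ, ∀ (m : ℕ) (t : ℕ → ALCQPIH.CTree NC NR),
          ALCQPIH.CTree.IsRun H D.nnf m t → m ≤ N) ∧
        -- the paths and the out-degrees in all generated trees are bounded
        (∀ (m : ℕ) (t : ℕ → ALCQPIH.CTree NC NR), ALCQPIH.CTree.IsRun H D.nnf m t →
          ∀ x ∈ (t m).nodes,
            x.length ≤ 2 ^ (4 * D.nnf.length * (D.nnf.rolesWith H).card) ∧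
            (t m).outDegree x ≤
              c * 2 ^ (max D.nnf.length ((D.nnf.rolesWith H).card / 2)) ^ 2) := by
  refine ⟨2 ^ 60, fun NC NR Q₀ _ H D _ => ?_⟩
  obtain ⟨⟨N, hN⟩, hbounds⟩ := mainTheorem4_general H D.isNNF_nnf
  exact ⟨⟨N, fun m t h => hN m t h.isRuleSeq⟩, fun m t h => hbounds m t h.isRuleSeq⟩
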